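/- Work over the field $\mathbb{C}$. Let $Z \subset \mathbb{P}^1 \times \mathbb{P}^1$ be a closed subscheme that is finite over $\mathbb{C}$, with ideal sheaf $\mathcal{I}_Z$, and let $l = \dim_{\mathbb{C}} H^0(\mathcal{O}_Z)$ be its length. Let $m$ and $n$ be non-negative integers such that $m + n \ge l - 1$. Assume that $\operatorname{length}(Z \cap D) \le n + 1$ for every line $D \subset \mathbb{P}^1 \times \mathbb{P}^1$ of bidegree $(1, 0)$, that is, for every fibre $D = \{a\} \times \mathbb{P}^1$ of the first projection over a closed point $a \in \mathbb{P}^1$. Assume that $\operatorname{length}(Z \cap E) \le m + 1$ for every line $E \subset \mathbb{P}^1 \times \mathbb{P}^1$ of bidegree $(0, 1)$, that is, for every fibre $E = \mathbb{P}^1 \times \{b\}$ of the second projection over a closed point $b \in \mathbb{P}^1$. Here the intersections are scheme-theoretic. Then $$H^1(\mathbb{P}^1 \times \mathbb{P}^1, \mathcal{I}_Z(m, n)) = 0,$$ where $\mathcal{I}_Z(m, n) = \mathcal{I}_Z \otimes \mathrm{pr}_1^* \mathcal{O}_{\mathbb{P}^1}(m) \otimes \mathrm{pr}_2^* \mathcal{O}_{\mathbb{P}^1}(n)$.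 -/

import Mathlib

open CategoryTheory AlgebraicGeometry TopologicalSpace Opposite

noncomputable section

namespace BiProj

/-! ### The scheme `ℙ¹ × ℙ¹` over `ℂ` -/

/-- The standard grading of the homogeneous coordinate ring `ℂ[x₀, x₁]`. -/
abbrev grading : ℕ → Submodule ℂ (MvPolynomial (Fin 2) ℂ) :=
  MvPolynomial.homogeneousSubmodule (Fin 2) ℂ

instance gradedAlgebra : GradedAlgebra grading := MvPolynomial.gradedAlgebra

/-- The base scheme `Spec ℂ`. -/
abbrev specC : Scheme.{0} := Spec (CommRingCat.of ℂ)

/-- The projective line `ℙ¹ = Proj ℂ[x₀, x₁]`. -/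
abbrev P1 : Scheme.{0} := Proj grading

/-- The structure morphism `ℙ¹ ⟶ Spec ℂ`. -/
def P1.toSpecC : P1 ⟶ specC :=
  Proj.toSpecZero grading ≫ Spec.map (CommRingCat.ofHom (algebraMap ℂ (grading 0)))

/-- The quadric surface `ℙ¹ × ℙ¹` over `ℂ`. -/
abbrev P1P1 : Scheme.{0} := Limits.pullback P1.toSpecC P1.toSpecC

/-- The first projection `ℙ¹ × ℙ¹ ⟶ ℙ¹`. -/
abbrev pr₁ : P1P1 ⟶ P1 := Limits.pullback.fst P1.toSpecC P1.toSpecC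

/-- The second projection `ℙ¹ × ℙ¹ ⟶ ℙ¹`. -/
abbrev pr₂ : P1P1 ⟶ P1 := Limits.pullback.snd P1.toSpecC P1.toSpecC

/-- The structure morphism `ℙ¹ × ℙ¹ ⟶ Spec ℂ`. -/
def P1P1.toSpecC : P1P1 ⟶ specC := pr₁ ≫ P1.toSpecC

/-! ### Lengths and lines -/

/-- The length of a finite `ℂ`-scheme `f : Z ⟶ Spec ℂ`: the dimension over `ℂ` of its algebra of
global functions. -/
def length {Z : Scheme.{0}} (f : Z ⟶ specC) : ℕ :=
  letI : Algebra ℂ Γ(Z, ⊤) := ((Scheme.ΓSpecIso (CommRingCat.of ℂ)).inv ≫ f.appTop).hom.toAlgebra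
  Module.finrank ℂ Γ(Z, ⊤)

/-- The inclusion in `ℙ¹ × ℙ¹` of the line `D = {a} × ℙ¹` of bidegree `(1, 0)`, the scheme-theoretic
fibre of the first projection over the point `a : Spec ℂ ⟶ ℙ¹`. -/
abbrev line₁₀ (a : specC ⟶ P1) : Limits.pullback pr₁ a ⟶ P1P1 := Limits.pullback.fst pr₁ a

/-- The inclusion in `ℙ¹ × ℙ¹` of the line `E = ℙ¹ × {b}` of bidegree `(0, 1)`, the scheme-theoretic
fibre of the second projection over the point `b : Spec ℂ ⟶ ℙ¹`. -/
abbrev line₀₁ (b : specC ⟶ P1) : Limits.pullback pr₂ b ⟶ P1P1 := Limits.pullback.fst pr₂ b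

/-- For subschemes `i : Z ⟶ ℙ¹ × ℙ¹` and `d : D ⟶ ℙ¹ × ℙ¹`, the length of the scheme-theoretic
intersection `Z ∩ D = Z ×_{ℙ¹ × ℙ¹} D`. -/
def lengthInter {Z D : Scheme.{0}} (i : Z ⟶ P1P1) (d : D ⟶ P1P1) : ℕ :=
  length (Limits.pullback.fst i d ≫ i ≫ P1P1.toSpecC)

/-! ### Twisted ideal sheaves -/

section Twist

variable {X Z : Scheme.{0}} (i : Z ⟶ X) {ι : Type} (V : ι → X.Opens)
  (g : ∀ p : ι, ι → Γ(X, V p))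

/-- Restriction of functions to a smaller open subscheme. -/
abbrev res {U W : X.Opens} (h : W ≤ U) : Γ(X, U) →+* Γ(X, W) := (X.presheaf.map (homOfLE h).op).hom

/-- Let `V p` be the members of an open cover of `X`, and `L` the line bundle which has a generator
`e p` on each `V p`, with `e q = g p q • e p` on `V p ⊓ V q`. For a closed immersion `i : Z ⟶ X`
with ideal sheaf `I_Z`, these are the sections over `U` of the sheaf `I_Z ⊗ L = I_Z L ⊆ L`. Such a
section is `s p • e p` on `U ⊓ V p`, where `s p` is a function on `U ⊓ V p` that vanishes on `Z`, and
where `s p = g p q * s q` on the overlap `U ⊓ V p ⊓ V q`. -/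
def twistSections (U : X.Opens) : AddSubgroup (∀ p, Γ(X, U ⊓ V p)) where
  carrier := {s | (∀ p, (i.app (U ⊓ V p)).hom (s p) = 0) ∧
    ∀ p q, res (W := U ⊓ V p ⊓ V q) inf_le_left (s p) =
      res (inf_le_left.trans inf_le_right) (g p q) *
        res (le_inf (inf_le_left.trans inf_le_left) inf_le_right) (s q)}
  add_mem' := by
    rintro s t ⟨hs, hs'⟩ ⟨ht, ht'⟩
    refine ⟨fun p => ?_, fun p q => ?_⟩
    · rw [Pi.add_apply, map_add, hs, ht, add_zero]
    · rw [Pi.add_apply, Pi.add_apply, map_add, map_add, hs', ht', mul_add]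
  zero_mem' := by
    refine ⟨fun p => ?_, fun p q => ?_⟩
    · rw [Pi.zero_apply, map_zero]
    · rw [Pi.zero_apply, Pi.zero_apply, map_zero, map_zero, mul_zero]
  neg_mem' := by
    rintro s ⟨hs, hs'⟩
    refine ⟨fun p => ?_, fun p q => ?_⟩
    · rw [Pi.neg_apply, map_neg, hs, neg_zero]
    · rw [Pi.neg_apply, Pi.neg_apply, map_neg, map_neg, hs', mul_neg]

lemma res_res {U W T : X.Opens} (h : W ≤ U) (h' : T ≤ W) (x : Γ(X, U)) :
    res h' (res h x) = res (h'.trans h) x := by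
  simp only [res, ← CommRingCat.comp_apply, ← Functor.map_comp, ← op_comp, homOfLE_comp]

lemma app_res {U W : X.Opens} (h : W ≤ U) (x : Γ(X, U)) :
    (i.app W).hom (res h x) = res (i.preimage_mono h) ((i.app U).hom x) := by
  have := i.naturality (homOfLE h).op
  exact congr($(this) x)

/-- Restriction of sections of the twisted ideal sheaf. -/
def twistRes {U W : X.Opens} (h : W ≤ U) : twistSections i V g U →+ twistSections i V g W where
  toFun s := ⟨fun p => res (inf_le_inf_right _ h) (s.1 p), by
    refine ⟨fun p => ?_, fun p q => ?_⟩
    · rw [app_res, s.2.1 p, map_zero]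
    · have := congr(res (W := W ⊓ V p ⊓ V q)
        (inf_le_inf_right _ (inf_le_inf_right _ h)) $(s.2.2 p q))
      rw [map_mul] at this
      simpa only [res_res] using this⟩
  map_zero' := by
    ext p
    exact map_zero _
  map_add' s t := by
    ext p
    exact map_add _ _ _

/-- The presheaf of sections of the twisted ideal sheaf. -/
def twistPresheaf : TopCat.Presheaf AddCommGrpCat.{0} X where
  obj U := AddCommGrpCat.of (twistSections i V g U.unop)
  map f := AddCommGrpCat.ofHom (twistRes i V g f.unop.le)
  map_id U := by
    ext s p
    change res _ (s.1 p) = s.1 p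
    exact congr($(X.presheaf.map_id _) (s.1 p))
  map_comp f f' := by
    ext s p
    exact (res_res _ _ _).symm

lemma res_ext {κ : Type} (U : κ → X.Opens) {W : X.Opens} (hU : ∀ k, U k ≤ W) (hW : W ≤ iSup U)
    {x y : Γ(X, W)} (h : ∀ k, res (hU k) x = res (hU k) y) : x = y :=
  X.sheaf.eq_of_locally_eq' U W (fun k => homOfLE (hU k)) hW x y h

theorem twistPresheaf_isSheaf : (twistPresheaf i V g).IsSheaf := by
  rw [TopCat.Presheaf.isSheaf_iff_isSheafUniqueGluing]
  intro κ U sf hsf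
  have key : ∀ p, ∃! t : Γ(X, iSup U ⊓ V p), ∀ k, X.presheaf.map
      (homOfLE (inf_le_inf_right (V p) (le_iSup U k))).op t = (sf k).1 p := by
    intro p
    refine X.sheaf.existsUnique_gluing' (fun k => U k ⊓ V p) (iSup U ⊓ V p)
      (fun k => homOfLE (inf_le_inf_right (V p) (le_iSup U k))) ?_ (fun k => (sf k).1 p) ?_
    · rw [iSup_inf_eq]
    · intro k k'
      have h := congr(res (W := (U k ⊓ V p) ⊓ (U k' ⊓ V p))
        (le_inf (inf_le_inf inf_le_left inf_le_left) (inf_le_left.trans inf_le_right))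
        ($(hsf k k').1 p))
      change res _ (res _ ((sf k).1 p)) = res _ (res _ ((sf k').1 p)) at h
      rw [res_res, res_res] at h
      exact h
  choose t ht htu using key
  have ht' : ∀ p k, res (inf_le_inf_right (V p) (le_iSup U k)) (t p) = (sf k).1 p := ht
  refine ⟨⟨t, ?_, ?_⟩, ?_, ?_⟩
  · intro p
    refine res_ext (fun k => i ⁻¹ᵁ (U k ⊓ V p))
      (fun k => i.preimage_mono (inf_le_inf_right (V p) (le_iSup U k))) ?_ fun k => ?_
    · intro z hz
      obtain ⟨hz, hz'⟩ := hz
      obtain ⟨k, hk⟩ := Opens.mem_iSup.mp hz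
      exact Opens.mem_iSup.mpr ⟨k, hk, hz'⟩
    · rw [← app_res i (inf_le_inf_right (V p) (le_iSup U k)), ht', (sf k).2.1 p, map_zero]
  · intro p q
    refine res_ext (fun k => U k ⊓ V p ⊓ V q)
      (fun k => inf_le_inf_right (V q) (inf_le_inf_right (V p) (le_iSup U k))) ?_ fun k => ?_
    · simp only [iSup_inf_eq, le_refl]
    · have h := (sf k).2.2 p q
      rw [← ht' p k, ← ht' q k] at h
      rw [map_mul]
      simpa only [res_res] using h
  · intro k
    apply Subtype.ext
    funext p
    exact ht p k
  · intro s hs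
    apply Subtype.ext
    funext p
    exact htu p (s.1 p) fun k => congr($(hs k).1 p)

/-- The twisted ideal sheaf `I_Z ⊗ L`, as a sheaf of abelian groups. -/
def twistSheaf : TopCat.Sheaf AddCommGrpCat.{0} X :=
  ⟨twistPresheaf i V g, twistPresheaf_isSheaf i V g⟩

end Twist

/-! ### The sheaves `I_Z(m, n)` on `ℙ¹ × ℙ¹` -/

/-- The standard open subset `D₊(xᵢ)` of `ℙ¹`. -/
abbrev P1.chart (i : Fin 2) : P1.Opens := Proj.basicOpen grading (MvPolynomial.X i)

/-- The function `x_k / x_i` on `D₊(xᵢ) ⊆ ℙ¹`. -/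
def P1.ratio (i k : Fin 2) : Γ(P1, P1.chart i) :=
  (Proj.awayToSection grading (MvPolynomial.X i)).hom
    (HomogeneousLocalization.Away.mk grading (MvPolynomial.isHomogeneous_X ℂ i) 1
      (MvPolynomial.X k) (by simpa using MvPolynomial.isHomogeneous_X ℂ k))

/-- The standard open cover of `ℙ¹ × ℙ¹` by the four subsets `D₊(xᵢ) × D₊(zⱼ)`. -/
abbrev chart (p : Fin 2 × Fin 2) : P1P1.Opens := pr₁ ⁻¹ᵁ P1.chart p.1 ⊓ pr₂ ⁻¹ᵁ P1.chart p.2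

/-- The function `(x_k / x_i) ^ m * (z_l / z_j) ^ n` on `D₊(xᵢ) × D₊(zⱼ)`, for `p = (i, j)` and
`q = (k, l)`. As `𝒪(m, n)` has the generator `xᵢ ^ m * zⱼ ^ n` on this open set, these are the
transition functions of the line bundle `𝒪(m, n)`. -/
def transition (m n : ℕ) (p q : Fin 2 × Fin 2) : Γ(P1P1, chart p) :=
  res inf_le_left ((pr₁.app (P1.chart p.1)).hom (P1.ratio p.1 q.1)) ^ m *
    res inf_le_right ((pr₂.app (P1.chart p.2)).hom (P1.ratio p.2 q.2)) ^ n

/-- The twisted ideal sheaf `I_Z(m, n) = I_Z ⊗ 𝒪(m, n)` of a closed subscheme `i : Z ⟶ ℙ¹ × ℙ¹`. -/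
def idealTwist {Z : Scheme.{0}} (i : Z ⟶ P1P1) (m n : ℕ) : TopCat.Sheaf AddCommGrpCat.{0} P1P1 :=
  twistSheaf i chart (transition m n)

end BiProj

end

/-!
For `F = I_Z(m, n)`, embedded in an injective sheaf, `H¹(F)` vanishes as soon as global sections of
the quotient lift (`subsingleton_H_one`). Lifts exist locally, and lifts over `U` and `W` can be corrected to agree on `U ⊓ W` if every section of `F` over
`U ⊓ W` is a difference of sections over `U` and over `W` (`Splits`, `LiftsOver.sup`). Over affine open
subsets of a standard chart this holds by an extension argument with powers of functions
(`splits_basicOpen`), so sections lift over each of the four charts. These are joined to two columns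
`ℙ¹ × D₊(zⱼ)`, and the columns to the whole surface.

For these joins, `𝒪(m, n)` itself splits, since a section over an intersection of charts is a
Laurent polynomial, and the bounds `0 ≤ m` and `0 ≤ n` make each of its monomials regular on one of the
two sides (`splits_lineBundle`). If global sections of `𝒪(m, n)` restrict surjectively to `Z`, then
`I_Z(m, n)` splits as well: a splitting `d = a - b` in `𝒪(m, n)` restricts to functions on `Z` which
agree on the overlap and so come from a function on `Z`, hence from a global section `w`, and
`d = (a - w) - (b - w)` is a splitting in `I_Z(m, n)` (`splits_idealTwist`).

It remains to restrict surjectively. Some linear forms `λ` and `μ` vanish at no point of `Z`, so that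
`Z` lies in the affine plane `D₊(λ) × D₊(μ)`, with coordinates `x` and `y`. The algebra of functions on
`Z` is generated by `x` and `y`, and the claim is that it is spanned by the polynomials of degree at
most `m` in `x` and at most `n` in `y` (`span_pow_mul_span_pow_eq_top`). This is proved by residuation:
for a function `c = x - a` or `c = y - b`, the span is everything if this holds, with one degree lowered
by one, on the residual scheme of `c`, and on the intersection with the line `c = 0`. If some line
`x = a` attains the bound `n + 1`, it is removed; this leaves length at most `m`, so that the bound on
the lines `y = b` holds in the residual scheme. If there is none, a line `y = b` which meets `Z` is
removed, and the lines `x = a` satisfy the stronger bound `n`.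
-/

noncomputable section

namespace BiProj

/-! ### Interpolation in finite-dimensional algebras -/

section FiniteAlgebra

/-- Powers up to `n` of a generator span a finite-dimensional algebra of dimension at most
`n + 1`, by the Cayley–Hamilton theorem for multiplication by the generator. -/
lemma span_pow_eq_top_of_finrank_le {A : Type*} [CommRing A] [Algebra ℂ A] [Module.Finite ℂ A]
    {y : A} (hy : Algebra.adjoin ℂ {y} = ⊤) {n : ℕ} (hn : Module.finrank ℂ A ≤ n + 1) :
    Submodule.span ℂ {1, y} ^ n = ⊤ := by
  have hpow : ∀ j ≤ n, y ^ j ∈ Submodule.span ℂ {1, y} ^ n := by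
    intro j hj
    have h1 : (1 : A) ∈ Submodule.span ℂ {1, y} := Submodule.subset_span (by simp)
    have h2 : y ∈ Submodule.span ℂ {1, y} := Submodule.subset_span (by simp)
    have := Submodule.mul_mem_mul (Submodule.pow_mem_pow _ h2 j)
      (Submodule.pow_mem_pow _ h1 (n - j))
    rwa [← pow_add, Nat.add_sub_cancel' hj, one_pow, mul_one] at this
  set f := LinearMap.charpoly (Algebra.lmul ℂ A y) with hf
  have hmonic : f.Monic := LinearMap.charpoly_monic _
  have hfy : Polynomial.aeval y f = 0 := by
    have h := LinearMap.aeval_self_charpoly (Algebra.lmul ℂ A y)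
    rw [Polynomial.aeval_algHom_apply] at h
    have h1 : Algebra.lmul ℂ A (Polynomial.aeval y f) 1 = 0 := congr($h 1)
    rwa [Algebra.coe_lmul_eq_mul, LinearMap.mul_apply', mul_one] at h1
  have hdeg : f.natDegree ≤ n + 1 := (LinearMap.charpoly_natDegree _).trans_le hn
  rw [eq_top_iff]
  intro z _
  have hz : z ∈ Algebra.adjoin ℂ {y} := hy ▸ Algebra.mem_top
  rw [Algebra.adjoin_singleton_eq_range_aeval] at hz
  obtain ⟨p, rfl⟩ := hz
  have hp : Polynomial.aeval y p = Polynomial.aeval y (p %ₘ f) := by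
    conv_lhs => rw [← Polynomial.modByMonic_add_div p f]
    simp [hfy]
  change Polynomial.aeval y p ∈ _
  rw [hp, Polynomial.aeval_eq_sum_range]
  refine Submodule.sum_mem _ fun j hj => ?_
  by_cases h1 : f = 1
  · simp [h1]
  refine Submodule.smul_mem _ _ (hpow j ?_)
  have := Polynomial.natDegree_modByMonic_lt p hmonic h1
  simp only [Finset.mem_range] at hj
  lia

/-- The quotient by the annihilator of `c` is isomorphic to the principal ideal `(c)`, whence the
dimension count. -/
lemma finrank_quotient_annihilator {A : Type*} [CommRing A] [Algebra ℂ A] [Module.Finite ℂ A]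
    (c : A) :
    Module.finrank ℂ (A ⧸ (Ideal.span {c}).annihilator) +
      Module.finrank ℂ (A ⧸ Ideal.span {c}) = Module.finrank ℂ A := by
  have h1 := Submodule.finrank_quotient_add_finrank ((Ideal.span {c}).restrictScalars ℂ)
  let e : (A ⧸ (Ideal.span {c}).annihilator) ≃ₗ[A] Ideal.span {c} :=
    (Submodule.quotEquivOfEq _ _ (by rw [Ideal.span, Submodule.annihilator_span_singleton])).trans
      (LinearMap.quotKerEquivRange (LinearMap.toSpanSingleton A A c) |>.trans
        (LinearEquiv.ofEq _ _ (LinearMap.range_toSpanSingleton c)))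
  have h2 : Module.finrank ℂ (A ⧸ (Ideal.span {c}).annihilator) =
      Module.finrank ℂ ((Ideal.span {c}).restrictScalars ℂ) :=
    (e.restrictScalars ℂ).finrank_eq
  have h3 : Module.finrank ℂ (A ⧸ Ideal.span {c}) =
      Module.finrank ℂ (A ⧸ (Ideal.span {c}).restrictScalars ℂ) := rfl
  lia

lemma map_span_one_pair {A B : Type*} [CommRing A] [Algebra ℂ A] [CommRing B] [Algebra ℂ B]
    (f : A →ₐ[ℂ] B) (x : A) :
    (Submodule.span ℂ {1, x}).map f.toLinearMap = Submodule.span ℂ {1, f x} := by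
  rw [Submodule.map_span, Set.image_pair]
  simp

/-- Residuation along the line `x = a`: if polynomials of bidegree `(m, n)` span the residual
algebra `A / Ann (x - a)` and the restriction `A / (x - a)` has dimension at most `n + 1`, then
polynomials of bidegree `(m + 1, n)` span `A`. -/
lemma span_pow_mul_span_pow_of_residual {A : Type*} [CommRing A] [Algebra ℂ A] [Module.Finite ℂ A]
    {x y : A} (hxy : Algebra.adjoin ℂ {x, y} = ⊤) (a : ℂ) {m n : ℕ}
    (ha : Module.finrank ℂ (A ⧸ Ideal.span {x - algebraMap ℂ A a}) ≤ n + 1)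
    (h : ∀ z : A, ∃ w ∈ Submodule.span ℂ {1, x} ^ m * Submodule.span ℂ {1, y} ^ n,
      (x - algebraMap ℂ A a) * z = (x - algebraMap ℂ A a) * w) :
    Submodule.span ℂ {1, x} ^ (m + 1) * Submodule.span ℂ {1, y} ^ n = ⊤ := by
  set c := x - algebraMap ℂ A a with hc
  have hc1 : c ∈ Submodule.span ℂ {1, x} := by
    refine Submodule.sub_mem _ (Submodule.subset_span (by simp)) ?_
    rw [Algebra.algebraMap_eq_smul_one]
    exact Submodule.smul_mem _ _ (Submodule.subset_span (by simp))
  have h1 : (1 : A) ∈ Submodule.span ℂ {1, x} := Submodule.subset_span (by simp)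
  let π := Ideal.Quotient.mkₐ ℂ (Ideal.span {c})
  have hπ : Function.Surjective π := Ideal.Quotient.mkₐ_surjective _ _
  have hπx : π x = algebraMap ℂ _ a := by
    rw [← sub_eq_zero, ← π.commutes, ← map_sub]
    exact Ideal.Quotient.eq_zero_iff_mem.mpr (Ideal.mem_span_singleton_self c)
  have hgen : Algebra.adjoin ℂ {π y} = ⊤ := by
    have := congr($(hxy).map π)
    rw [AlgHom.map_adjoin, Algebra.map_top, (AlgHom.range_eq_top π).mpr hπ, Set.image_pair,
      hπx] at this
    rw [eq_top_iff, ← this, Algebra.adjoin_le_iff]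
    rintro z (rfl | hz)
    · exact Subalgebra.algebraMap_mem _ _
    · exact Algebra.subset_adjoin hz
  have htop := span_pow_eq_top_of_finrank_le hgen ha
  rw [eq_top_iff]
  intro z _
  have hz : π z ∈ Submodule.span ℂ {1, π y} ^ n := htop ▸ Submodule.mem_top
  rw [← map_span_one_pair, ← Submodule.map_pow] at hz
  obtain ⟨w, hw, hwz⟩ := hz
  have hw' : w ∈ Submodule.span ℂ {1, x} ^ (m + 1) * Submodule.span ℂ {1, y} ^ n := by
    have := Submodule.mul_mem_mul (Submodule.pow_mem_pow _ h1 (m + 1)) hw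
    rwa [one_pow, one_mul] at this
  have hzw : z - w ∈ Ideal.span {c} := by
    refine Ideal.Quotient.eq_zero_iff_mem.mp ?_
    change π (z - w) = 0
    rw [map_sub, sub_eq_zero]
    exact hwz.symm
  obtain ⟨q, hq⟩ := Ideal.mem_span_singleton'.mp hzw
  obtain ⟨w', hw'', hqw⟩ := h q
  rw [← sub_add_cancel z w, ← hq, mul_comm q, hqw]
  refine Submodule.add_mem _ ?_ hw'
  rw [pow_succ', mul_assoc]
  exact Submodule.mul_mem_mul hc1 hw''

/-- A quotient of a quotient has smaller dimension. -/
lemma finrank_quotient_le_of_surjective {A B : Type*} [CommRing A] [Algebra ℂ A]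
    [Module.Finite ℂ A] [CommRing B] [Algebra ℂ B] (f : A →ₐ[ℂ] B) (hf : Function.Surjective f)
    (c : A) :
    Module.finrank ℂ (B ⧸ Ideal.span {f c}) ≤ Module.finrank ℂ (A ⧸ Ideal.span {c}) := by
  let g : (A ⧸ Ideal.span {c}) →ₐ[ℂ] (B ⧸ Ideal.span {f c}) :=
    Ideal.quotientMapₐ _ f (by
      rw [Ideal.span_singleton_le_iff_mem]
      exact Ideal.mem_span_singleton_self _)
  have hg : Function.Surjective g := by
    intro z
    obtain ⟨z, rfl⟩ := Ideal.Quotient.mk_surjective z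
    obtain ⟨z, rfl⟩ := hf z
    exact ⟨Ideal.Quotient.mk _ z, rfl⟩
  exact LinearMap.finrank_le_finrank_of_surjective (f := g.toLinearMap) hg

lemma finrank_quotient_le {A : Type*} [CommRing A] [Algebra ℂ A] [Module.Finite ℂ A]
    (I : Ideal A) : Module.finrank ℂ (A ⧸ I) ≤ Module.finrank ℂ A :=
  LinearMap.finrank_le_finrank_of_surjective (f := (Ideal.Quotient.mkₐ ℂ I).toLinearMap)
    (Ideal.Quotient.mkₐ_surjective ℂ I)

/-- The step of `span_pow_mul_span_pow_of_residual`, with its hypothesis stated in the residual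
algebra. -/
lemma span_pow_mul_span_pow_of_quotient {A : Type*} [CommRing A] [Algebra ℂ A] [Module.Finite ℂ A]
    {x y : A} (hxy : Algebra.adjoin ℂ {x, y} = ⊤) (a : ℂ) {m n : ℕ}
    (ha : Module.finrank ℂ (A ⧸ Ideal.span {x - algebraMap ℂ A a}) ≤ n + 1)
    (h : let π := Ideal.Quotient.mkₐ ℂ (Ideal.span {x - algebraMap ℂ A a}).annihilator
      Submodule.span ℂ {1, π x} ^ m * Submodule.span ℂ {1, π y} ^ n = ⊤) :
    Submodule.span ℂ {1, x} ^ (m + 1) * Submodule.span ℂ {1, y} ^ n = ⊤ := by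
  refine span_pow_mul_span_pow_of_residual hxy a ha fun z => ?_
  set π := Ideal.Quotient.mkₐ ℂ (Ideal.span {x - algebraMap ℂ A a}).annihilator with hπ
  have hz : π z ∈ Submodule.span ℂ {1, π x} ^ m * Submodule.span ℂ {1, π y} ^ n :=
    h ▸ Submodule.mem_top
  rw [← map_span_one_pair, ← map_span_one_pair, ← Submodule.map_pow, ← Submodule.map_pow,
    ← Submodule.map_mul] at hz
  obtain ⟨w, hw, hwz⟩ := hz
  refine ⟨w, hw, ?_⟩
  have hzw : z - w ∈ (Ideal.span {x - algebraMap ℂ A a}).annihilator := by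
    refine Ideal.Quotient.eq_zero_iff_mem.mp ?_
    change π (z - w) = 0
    rw [map_sub, sub_eq_zero]
    exact hwz.symm
  rw [Submodule.mem_annihilator] at hzw
  have := hzw _ (Ideal.mem_span_singleton_self _)
  rw [smul_eq_mul] at this
  linear_combination this

lemma exists_finrank_quotient_pos {A : Type*} [CommRing A] [Algebra ℂ A] [Module.Finite ℂ A]
    [Nontrivial A] (y : A) :
    ∃ b : ℂ, 0 < Module.finrank ℂ (A ⧸ Ideal.span {y - algebraMap ℂ A b}) := by
  obtain ⟨b, hb⟩ := spectrum.nonempty_of_isAlgClosed_of_finiteDimensional ℂ y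
  refine ⟨b, ?_⟩
  have : Nontrivial (A ⧸ Ideal.span {y - algebraMap ℂ A b}) := by
    rw [Ideal.Quotient.nontrivial_iff, Ne, Ideal.span_singleton_eq_top]
    rw [spectrum.mem_iff] at hb
    rwa [← neg_sub, IsUnit.neg_iff]
  exact Module.finrank_pos

/-- The interpolation theorem for zero-dimensional subschemes of `𝔸¹ × 𝔸¹`: polynomials of bidegree
`(m, n)` represent all functions on a subscheme of length at most `m + n + 1` which meets vertical
lines in length at most `n + 1` and horizontal lines in length at most `m + 1`. A line which
attains the first bound is split off; if there is none, any horizontal line that meets the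
subscheme can be split off. -/
theorem span_pow_mul_span_pow_eq_top {A : Type*} [CommRing A] [Algebra ℂ A] [Module.Finite ℂ A]
    {x y : A} (hxy : Algebra.adjoin ℂ {x, y} = ⊤) {m n : ℕ} (hA : Module.finrank ℂ A ≤ m + n + 1)
    (hx : ∀ a : ℂ, Module.finrank ℂ (A ⧸ Ideal.span {x - algebraMap ℂ A a}) ≤ n + 1)
    (hy : ∀ b : ℂ, Module.finrank ℂ (A ⧸ Ideal.span {y - algebraMap ℂ A b}) ≤ m + 1) :
    Submodule.span ℂ {1, x} ^ m * Submodule.span ℂ {1, y} ^ n = ⊤ := by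
  obtain ⟨k, hk⟩ : ∃ k, m + n = k := ⟨_, rfl⟩
  induction k using Nat.strong_induction_on generalizing A m n with
  | _ k ih =>
  rcases subsingleton_or_nontrivial A with hsub | hnontriv
  · exact Subsingleton.elim _ _
  have hquot (c : A) := finrank_quotient_annihilator c
  have hgen (I : Ideal A) :
      Algebra.adjoin ℂ {Ideal.Quotient.mkₐ ℂ I x, Ideal.Quotient.mkₐ ℂ I y} = ⊤ := by
    rw [← Set.image_pair, ← AlgHom.map_adjoin, hxy, Algebra.map_top, AlgHom.range_eq_top]
    exact Ideal.Quotient.mkₐ_surjective _ _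
  have hle (I : Ideal A) (z : A) (c : ℂ) :
      Module.finrank ℂ ((A ⧸ I) ⧸ Ideal.span {Ideal.Quotient.mkₐ ℂ I z - algebraMap ℂ _ c}) ≤
        Module.finrank ℂ (A ⧸ Ideal.span {z - algebraMap ℂ A c}) := by
    have := finrank_quotient_le_of_surjective (Ideal.Quotient.mkₐ ℂ I)
      (Ideal.Quotient.mkₐ_surjective _ _) (z - algebraMap ℂ A c)
    rwa [map_sub, AlgHom.commutes] at this
  by_cases hex : ∃ a : ℂ, Module.finrank ℂ (A ⧸ Ideal.span {x - algebraMap ℂ A a}) = n + 1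
  · obtain ⟨a, ha⟩ := hex
    have hq := hquot (x - algebraMap ℂ A a)
    rcases m with _ | m
    · -- The whole subscheme lies on the line `x = a`.
      have h0 : Module.finrank ℂ (A ⧸ (Ideal.span {x - algebraMap ℂ A a}).annihilator) = 0 := by
        lia
      have h1 := Module.finrank_zero_iff.mp h0
      rw [Ideal.Quotient.subsingleton_iff, Submodule.annihilator_eq_top_iff,
        Ideal.span_singleton_eq_bot, sub_eq_zero] at h1
      rw [pow_zero, one_mul]
      refine span_pow_eq_top_of_finrank_le ?_ (by lia)
      rw [eq_top_iff, ← hxy, Algebra.adjoin_le_iff]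
      rintro z (rfl | hz)
      · exact h1 ▸ Subalgebra.algebraMap_mem _ _
      · exact Algebra.subset_adjoin hz
    · refine span_pow_mul_span_pow_of_quotient hxy a ha.le ?_
      refine ih (m + n) (by lia) (hgen _) (by lia) (fun c => (hle _ _ _).trans (hx c))
        (fun c => ?_) rfl
      exact (finrank_quotient_le _).trans (by lia)
  · have hx' (a : ℂ) : Module.finrank ℂ (A ⧸ Ideal.span {x - algebraMap ℂ A a}) ≤ n := by
      have := hx a
      have : Module.finrank ℂ (A ⧸ Ideal.span {x - algebraMap ℂ A a}) ≠ n + 1 :=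
        fun h => hex ⟨a, h⟩
      lia
    obtain ⟨a, ha⟩ := exists_finrank_quotient_pos x
    obtain ⟨b, hb⟩ := exists_finrank_quotient_pos y
    obtain ⟨n, rfl⟩ : ∃ n', n = n' + 1 := ⟨n - 1, by have := hx' a; lia⟩
    have hq := hquot (y - algebraMap ℂ A b)
    rw [mul_comm]
    refine span_pow_mul_span_pow_of_quotient (by rwa [Set.pair_comm]) b (hy b) ?_
    intro π
    rw [mul_comm]
    exact ih (m + n) (by lia) (hgen _) (by lia) (fun c => (hle _ _ _).trans (hx' c))
      (fun c => (hle _ _ _).trans (hy c)) rfl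

end FiniteAlgebra

/-! ### Cohomology and lifting of sections -/

section Lifting

variable {X : TopCat.{0}}

/-- Restriction of sections of a sheaf of abelian groups. -/
abbrev sheafRes (F : TopCat.Sheaf AddCommGrpCat.{0} X) {U W : Opens X} (h : W ≤ U) :
    F.obj.obj (op U) →+ F.obj.obj (op W) := (F.obj.map (homOfLE h).op).hom

lemma sheafRes_sheafRes (F : TopCat.Sheaf AddCommGrpCat.{0} X) {U W T : Opens X} (h : W ≤ U)
    (h' : T ≤ W) (s : F.obj.obj (op U)) :
    sheafRes F h' (sheafRes F h s) = sheafRes F (h'.trans h) s := by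
  simp only [sheafRes, ← AddCommGrpCat.comp_apply, ← Functor.map_comp, ← op_comp, homOfLE_comp]

/-- A sheaf morphism on sections over an open set. -/
abbrev appSec {F G : TopCat.Sheaf AddCommGrpCat.{0} X} (φ : F ⟶ G) (U : Opens X) :
    F.obj.obj (op U) →+ G.obj.obj (op U) := (φ.hom.app (op U)).hom

lemma appSec_sheafRes {F G : TopCat.Sheaf AddCommGrpCat.{0} X} (φ : F ⟶ G) {U W : Opens X}
    (h : W ≤ U) (s : F.obj.obj (op U)) :
    appSec φ W (sheafRes F h s) = sheafRes G h (appSec φ U s) := by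
  have := φ.hom.naturality (homOfLE h).op
  exact congr($(this) s)

/-- Every section of `F` over `U ⊓ W` is a difference of sections over `U` and over `W`, that is,
the connecting map `F(U ⊓ W) → H¹(U ⊔ W, F)` of Mayer–Vietoris vanishes. -/
def Splits (F : TopCat.Sheaf AddCommGrpCat.{0} X) (U W : Opens X) : Prop :=
  ∀ d : F.obj.obj (op (U ⊓ W)), ∃ (a : F.obj.obj (op U)) (b : F.obj.obj (op W)),
    d = sheafRes F inf_le_left a - sheafRes F inf_le_right b

/-- The global section `q` of the quotient in a short complex of sheaves lifts over `U`. -/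
def LiftsOver {S : ShortComplex (TopCat.Sheaf AddCommGrpCat.{0} X)} (q : S.X₃.obj.obj (op ⊤))
    (U : Opens X) : Prop :=
  ∃ t : S.X₂.obj.obj (op U), appSec S.g U t = sheafRes S.X₃ le_top q

lemma LiftsOver.mono {S : ShortComplex (TopCat.Sheaf AddCommGrpCat.{0} X)}
    {q : S.X₃.obj.obj (op ⊤)} {U W : Opens X} (hU : LiftsOver q U) (h : W ≤ U) :
    LiftsOver q W := by
  obtain ⟨t, ht⟩ := hU
  exact ⟨sheafRes _ h t, by rw [appSec_sheafRes, ht, sheafRes_sheafRes]⟩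

lemma LiftsOver.exists_nhds {S : ShortComplex (TopCat.Sheaf AddCommGrpCat.{0} X)}
    (hS : S.ShortExact) (q : S.X₃.obj.obj (op ⊤)) (x : X) :
    ∃ U : Opens X, x ∈ U ∧ LiftsOver q U := by
  have := (TopCat.Sheaf.isLocallySurjective_iff_epi S.g).mpr hS.epi_g
  obtain ⟨U, hU, ⟨t, ht⟩, hx⟩ :=
    (TopCat.Presheaf.isLocallySurjective_iff S.g.hom).mp this ⊤ q x trivial
  exact ⟨U, hx, t, ht⟩

/-- Lifts over `U` and `W` can be corrected to agree on the overlap if `F` splits there. -/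
lemma LiftsOver.sup {S : ShortComplex (TopCat.Sheaf AddCommGrpCat.{0} X)}
    (hS : S.ShortExact) {q : S.X₃.obj.obj (op ⊤)} {U W : Opens X} (hU : LiftsOver q U)
    (hW : LiftsOver q W) (hspl : Splits S.X₁ U W) : LiftsOver q (U ⊔ W) := by
  obtain ⟨t, ht⟩ := hU
  obtain ⟨t', ht'⟩ := hW
  have h0 : appSec S.g (U ⊓ W) (sheafRes _ inf_le_left t - sheafRes _ inf_le_right t') = 0 := by
    rw [map_sub, appSec_sheafRes, appSec_sheafRes, ht, ht', sheafRes_sheafRes, sheafRes_sheafRes,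
      sub_self]
  obtain ⟨d, hd⟩ := TopCat.Sheaf.sections_exact_of_left_exact hS.1 hS.2 _ h0
  obtain ⟨a, b, rfl⟩ := hspl d
  have hzero (T : Opens X) (c : S.X₁.obj.obj (op T)) : appSec S.g T (appSec S.f T c) = 0 := by
    have : (S.f ≫ S.g).hom.app (op T) = 0 := by rw [S.zero]; rfl
    exact congr($this c)
  replace hd : appSec S.f (U ⊓ W) (sheafRes _ inf_le_left a - sheafRes _ inf_le_right b) =
    sheafRes _ inf_le_left t - sheafRes _ inf_le_right t' := hd
  rw [map_sub, appSec_sheafRes, appSec_sheafRes, sub_eq_sub_iff_sub_eq_sub, ← map_sub,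
    ← map_sub] at hd
  let U' : Bool → Opens X := fun c => bif c then U else W
  let sf : ∀ c, S.X₂.obj.obj (op (U' c)) := fun c =>
    match c with
    | true => appSec S.f U a - t
    | false => appSec S.f W b - t'
  obtain ⟨r, hr, -⟩ := S.X₂.existsUnique_gluing' U' (U ⊔ W)
    (fun c => homOfLE (by cases c; exacts [le_sup_right, le_sup_left]))
    (sup_le (le_iSup U' true) (le_iSup U' false)) sf (by
      rintro (_ | _) (_ | _)
      · rfl
      · have := congr(sheafRes S.X₂ (le_of_eq (inf_comm W U)) $hd)
        rw [sheafRes_sheafRes, sheafRes_sheafRes] at this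
        exact this.symm
      · exact hd
      · rfl)
  have hrt : sheafRes S.X₂ le_sup_left r = appSec S.f U a - t := hr true
  have hrf : sheafRes S.X₂ le_sup_right r = appSec S.f W b - t' := hr false
  refine ⟨-r, ?_⟩
  refine S.X₃.eq_of_locally_eq₂ (homOfLE le_sup_left) (homOfLE le_sup_right) le_rfl _ _ ?_ ?_
  · change sheafRes S.X₃ le_sup_left _ = sheafRes S.X₃ le_sup_left _
    rw [← appSec_sheafRes, map_neg, hrt, map_neg, map_sub, hzero, ht, sheafRes_sheafRes]
    simp
  · change sheafRes S.X₃ le_sup_right _ = sheafRes S.X₃ le_sup_right _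
    rw [← appSec_sheafRes, map_neg, hrf, map_neg, map_sub, hzero, ht', sheafRes_sheafRes]
    simp

lemma LiftsOver.bot {S : ShortComplex (TopCat.Sheaf AddCommGrpCat.{0} X)}
    (q : S.X₃.obj.obj (op ⊤)) : LiftsOver q ⊥ :=
  ⟨0, S.X₃.eq_of_locally_eq' (fun k : Empty => k.elim) ⊥ (fun k => k.elim) bot_le _ _
    fun k => k.elim⟩

/-- `H¹` vanishes if global sections of quotients by `F` lift: embed `F` in an injective sheaf and
use the long exact sequence. -/
theorem subsingleton_H_one_of_surjective {C : Type} [Category.{0} C] {J : GrothendieckTopology C}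
    {T : C} (hT : Limits.IsTerminal T) (F : Sheaf J AddCommGrpCat.{0})
    (h : ∀ S : ShortComplex (Sheaf J AddCommGrpCat.{0}), S.ShortExact → S.X₁ = F →
      ∀ q : S.X₃.obj.obj (op T), ∃ t : S.X₂.obj.obj (op T), (S.g.hom.app (op T)).hom t = q) :
    Subsingleton (Sheaf.H F 1) := by
  let S : ShortComplex (Sheaf J AddCommGrpCat.{0}) :=
    ShortComplex.mk (Injective.ι F) (Limits.cokernel.π (Injective.ι F)) (by simp)
  have hS : S.ShortExact :=
    { exact := ShortComplex.exact_cokernel _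
      mono_f := inferInstanceAs (Mono (Injective.ι F))
      epi_g := inferInstanceAs (Epi (Limits.cokernel.π (Injective.ι F))) }
  refine subsingleton_of_forall_eq 0 fun x => ?_
  have hinj : Injective S.X₂ := inferInstanceAs (Injective (Injective.under F))
  obtain ⟨y, rfl⟩ := Abelian.Ext.covariant_sequence_exact₁ _ hS x
    (Abelian.Ext.eq_zero_of_injective _) (zero_add 1)
  obtain ⟨t, ht⟩ := h S hS rfl (Sheaf.H.equiv₀ S.X₃ hT y)
  have hy : Sheaf.H.map S.g 0 ((Sheaf.H.equiv₀ S.X₂ hT).symm t) = y := by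
    apply (Sheaf.H.equiv₀ S.X₃ hT).injective
    rw [← Sheaf.H.equiv₀_naturality, AddEquiv.apply_symm_apply]
    exact ht
  rw [← hy, Sheaf.H.map_apply, Abelian.Ext.comp_assoc_of_second_deg_zero]
  rw [hS.comp_extClass, Abelian.Ext.comp_zero]

theorem subsingleton_H_one (F : TopCat.Sheaf AddCommGrpCat.{0} X)
    (h : ∀ S : ShortComplex (TopCat.Sheaf AddCommGrpCat.{0} X), S.ShortExact → S.X₁ = F →
      ∀ q : S.X₃.obj.obj (op ⊤), LiftsOver q ⊤) :
    Subsingleton (Sheaf.H F 1) := by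
  refine subsingleton_H_one_of_surjective (T := (⊤ : Opens X)) Limits.isTerminalTop F
    fun S hS hSF q => ?_
  obtain ⟨t, ht⟩ := h S hS hSF q
  exact ⟨t, ht.trans congr($(S.X₃.obj.map_id _) q)⟩

end Lifting

/-! ### Twisted ideal sheaves over affine open sets -/

section AffineLifting

variable {X : Scheme.{0}}

/-- A sheaf which splits on the cover of an affine open set by two principal open subsets lets
sections of its quotients lift over affine open sets: the functions `f` with a lift over `D(f)` form
an ideal. -/
theorem LiftsOver.of_isAffineOpen {S : ShortComplex (TopCat.Sheaf AddCommGrpCat.{0} X)}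
    (hS : S.ShortExact) (q : S.X₃.obj.obj (op ⊤)) {W : X.Opens} (hW : IsAffineOpen W)
    (hspl : ∀ U : X.Opens, U ≤ W → IsAffineOpen U → ∀ f h : Γ(X, U), IsCoprime f h →
      Splits S.X₁ (X.basicOpen f) (X.basicOpen h)) : LiftsOver q W := by
  let J : Ideal Γ(X, W) :=
    { carrier := {f | LiftsOver q (X.basicOpen f)}
      zero_mem' := by
        change LiftsOver q (X.basicOpen 0)
        rw [Scheme.basicOpen_zero]
        exact LiftsOver.bot q
      smul_mem' := fun a f hf => LiftsOver.mono hf (by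
        rw [smul_eq_mul, Scheme.basicOpen_mul]
        exact inf_le_right)
      add_mem' := by
        intro f h hf hh
        change LiftsOver q (X.basicOpen (f + h))
        set U := X.basicOpen (f + h) with hU
        have hUW : U ≤ W := X.basicOpen_le _
        have hUaff : IsAffineOpen U := hW.basicOpen _
        have hunit : IsUnit (res hUW f + res hUW h) := by
          rw [← map_add]
          exact X.toRingedSpace.isUnit_res_basicOpen (f + h)
        have hcop : IsCoprime (res hUW f) (res hUW h) := by
          obtain ⟨u, hu⟩ := hunit
          exact ⟨↑u⁻¹, ↑u⁻¹, by rw [← mul_add, ← hu, Units.inv_mul]⟩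
        have hle (g : Γ(X, W)) : X.basicOpen (res hUW g) ≤ X.basicOpen g := by
          rw [Scheme.basicOpen_res]
          exact inf_le_right
        have key := LiftsOver.sup hS (LiftsOver.mono hf (hle f)) (LiftsOver.mono hh (hle h))
          (hspl U hUW hUaff _ _ hcop)
        refine LiftsOver.mono key ?_
        intro x hx
        by_contra hx'
        rw [← SetLike.mem_coe, Opens.coe_sup, Set.mem_union, not_or, SetLike.mem_coe,
          SetLike.mem_coe, X.mem_basicOpen _ x hx, X.mem_basicOpen _ x hx] at hx'
        have := hunit.map (X.presheaf.germ U x hx).hom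
        rw [map_add] at this
        rcases IsLocalRing.isUnit_or_isUnit_of_isUnit_add this with h1 | h1
        · exact hx'.1 h1
        · exact hx'.2 h1 }
  have hJ : Ideal.span (J : Set Γ(X, W)) = ⊤ := by
    rw [← hW.iSup_basicOpen_eq_self_iff]
    refine le_antisymm (iSup_le fun f => X.basicOpen_le _) fun x hx => ?_
    obtain ⟨V, hxV, hV⟩ := LiftsOver.exists_nhds hS q x
    obtain ⟨f, hf, hxf⟩ := hW.exists_basicOpen_le ⟨x, hxV⟩ hx
    exact Opens.mem_iSup.mpr ⟨⟨f, hV.mono hf⟩, hxf⟩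
  rw [Ideal.span_eq, Ideal.eq_top_iff_one] at hJ
  have : LiftsOver q (X.basicOpen (1 : Γ(X, W))) := hJ
  rwa [Scheme.basicOpen_of_isUnit _ isUnit_one] at this

/-- A function on `D(φ)` which vanishes on `Z` extends to such a function on the ambient affine
open set after multiplication by a power of `φ`. -/
lemma exists_extend_of_app_eq_zero {Z : Scheme.{0}} (i : Z ⟶ X) [IsAffineHom i] {U D : X.Opens}
    (hU : IsAffineOpen U) (φ : Γ(X, U)) (hD : D = X.basicOpen φ) (hDU : D ≤ U) (δ : Γ(X, D))
    (hδ : (i.app D).hom δ = 0) :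
    ∃ (N : ℕ) (e : Γ(X, U)), (i.app U).hom e = 0 ∧ res hDU e = res hDU φ ^ N * δ := by
  subst hD
  obtain ⟨n, y, hy⟩ := exists_eq_pow_mul_of_isCompact_of_isQuasiSeparated X U hU.isCompact
    hU.isQuasiSeparated φ δ
  replace hy : res hDU y = res hDU φ ^ n * δ := hy
  have h0 : res (i.preimage_mono hDU) ((i.app U).hom y) = 0 := by
    rw [← app_res i hDU, hy, map_mul, hδ, mul_zero]
  have hle : Z.basicOpen ((i.app U).hom φ) ≤ i ⁻¹ᵁ X.basicOpen φ :=
    (Scheme.preimage_basicOpen i φ).ge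
  obtain ⟨k, hk⟩ := exists_pow_mul_eq_zero_of_res_basicOpen_eq_zero_of_isCompact Z
    (hU.preimage i).isCompact ((i.app U).hom y) ((i.app U).hom φ) (by
      change res (Z.basicOpen_le _) ((i.app U).hom y) = 0
      rw [← res_res (h := i.preimage_mono hDU) (h' := hle), h0, map_zero])
  refine ⟨k + n, φ ^ k * y, ?_, ?_⟩
  · rw [map_mul, map_pow, hk]
  · rw [map_mul, map_pow, hy, pow_add, mul_assoc]

variable {Z : Scheme.{0}} (i : Z ⟶ X) {ι : Type} {V : ι → X.Opens} {g : ∀ p : ι, ι → Γ(X, V p)}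

/-- The functions `g p q` satisfy the cocycle condition, so that they are the transition functions
of a line bundle. -/
structure IsCocycle (g : ∀ p : ι, ι → Γ(X, V p)) : Prop where
  self (p : ι) : g p p = 1
  trans (p q r : ι) :
    res (W := V p ⊓ V q) inf_le_left (g p q) * res inf_le_right (g q r) = res inf_le_left (g p r)

lemma IsCocycle.mul_res (hg : IsCocycle g) (p q r : ι) {W : X.Opens} (hp : W ≤ V p) (hq : W ≤ V q) :
    res hp (g p q) * res hq (g q r) = res hp (g p r) := by
  have := congr(res (le_inf hp hq) $(hg.trans p q r))
  rwa [map_mul, res_res, res_res, res_res] at this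

lemma twistSections_compat {U : X.Opens} (s : twistSections i V g U) (p q : ι) {W : X.Opens}
    (hU : W ≤ U) (hp : W ≤ V p) (hq : W ≤ V q) :
    res (le_inf hU hp) (s.1 p) = res hp (g p q) * res (le_inf hU hq) (s.1 q) := by
  have := congr(res (le_inf (le_inf hU hp) hq) $(s.2.2 p q))
  rwa [map_mul, res_res, res_res, res_res] at this

/-- On an open subset of `V p`, sections of the twisted ideal sheaf are determined by their
component at `p`. -/
lemma twistSections_ext {U : X.Opens} {p : ι} (hU : U ≤ V p) {s t : twistSections i V g U}
    (h : s.1 p = t.1 p) : s = t := by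
  apply Subtype.ext
  funext q
  have hs := twistSections_compat i s q p (W := U ⊓ V q) inf_le_left inf_le_right
    (inf_le_left.trans hU)
  have ht := twistSections_compat i t q p (W := U ⊓ V q) inf_le_left inf_le_right
    (inf_le_left.trans hU)
  rw [h, ← ht] at hs
  have hid (x : Γ(X, U ⊓ V q)) : res (W := U ⊓ V q) (le_inf inf_le_left inf_le_right) x = x :=
    congr($(X.presheaf.map_id _) x)
  rwa [hid, hid] at hs

/-- The generator at `p` extends to all of `X` because the transition functions `g q p` are regular on
`V q`, so that functions which vanish on `Z` give sections of the twisted ideal sheaf. -/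
lemma exists_twistSections (hg : IsCocycle g) {U : X.Opens} (p : ι) (f : Γ(X, U))
    (hf : (i.app U).hom f = 0) :
    ∃ s : twistSections i V g U, s.1 p = res inf_le_left f := by
  refine ⟨⟨fun q => res inf_le_right (g q p) * res inf_le_left f, fun q => ?_, fun q r => ?_⟩, ?_⟩
  · rw [map_mul, app_res i _ f, hf, map_zero, mul_zero]
  · rw [map_mul, map_mul, res_res, res_res, res_res, res_res, ← mul_assoc]
    rw [hg.mul_res q r p (inf_le_left.trans inf_le_right) inf_le_right]
  · change res _ (g p p) * _ = _
    rw [hg.self, map_one, one_mul]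

/-- The twisted ideal sheaf has the splitting property on affine open subsets of `V p`. -/
lemma splits_basicOpen [IsAffineHom i] (hg : IsCocycle g) {p : ι} {U : X.Opens} (hUp : U ≤ V p)
    (hU : IsAffineOpen U) (f h : Γ(X, U)) (hfh : IsCoprime f h) :
    Splits (twistSheaf i V g) (X.basicOpen f) (X.basicOpen h) := by
  intro (d : twistSections i V g (X.basicOpen f ⊓ X.basicOpen h))
  let D : X.Opens := X.basicOpen f ⊓ X.basicOpen h
  have hfU := X.basicOpen_le f
  have hhU := X.basicOpen_le h
  have hDU : D ≤ U := inf_le_left.trans hfU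
  have hDp : D ≤ V p := hDU.trans hUp
  obtain ⟨δ, hd, hδ⟩ : ∃ δ : Γ(X, D), d.1 p = res inf_le_left δ ∧ (i.app D).hom δ = 0 := by
    refine ⟨res (le_inf le_rfl hDp) (d.1 p), ?_, by rw [app_res, d.2.1 p, map_zero]⟩
    rw [res_res]
    exact congr($((X.presheaf.map_id _).symm) (d.1 p))
  obtain ⟨N, e, he, heδ⟩ := exists_extend_of_app_eq_zero i (hU.basicOpen h) (res hhU f)
    (by rw [Scheme.basicOpen_res, inf_comm]) (D := D) inf_le_right δ hδ
  obtain ⟨M, e', he', heδ'⟩ := exists_extend_of_app_eq_zero i (hU.basicOpen f) (res hfU h)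
    (by rw [Scheme.basicOpen_res]) (D := D) inf_le_left δ hδ
  obtain ⟨a, b, hab⟩ : IsCoprime (f ^ N) (h ^ M) := hfh.pow
  obtain ⟨s, hs⟩ := exists_twistSections i hg p (res hfU b * e')
    (by rw [map_mul, he', mul_zero])
  obtain ⟨t, ht⟩ := exists_twistSections i hg p (res hhU (-a) * e)
    (by rw [map_mul, he, mul_zero])
  refine ⟨s, t, ?_⟩
  apply twistSections_ext i hDp
  change d.1 p = res _ (s.1 p) - res _ (t.1 p)
  rw [hs, ht, hd, res_res, res_res]
  rw [← res_res (W := D) (h := inf_le_left) (h' := inf_le_left),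
    ← res_res (W := D) (h := inf_le_right) (h' := inf_le_left), ← map_sub]
  congr 1
  rw [map_mul, map_mul, heδ, heδ', res_res, res_res, res_res, res_res, map_neg]
  have := congr(res hDU $hab)
  rw [map_add, map_mul, map_mul, map_pow, map_pow, map_one] at this
  linear_combination (-δ) * this

end AffineLifting

/-! ### Fractions of linear forms and points of the projective line -/

section Constants

/-- The constant functions on an open subset of a `ℂ`-scheme `s : X ⟶ Spec ℂ`. -/
def constHom {X : Scheme.{0}} (s : X ⟶ specC) (U : X.Opens) : ℂ →+* Γ(X, U) :=
  ((Scheme.ΓSpecIso (CommRingCat.of ℂ)).inv ≫ s.appLE ⊤ U le_top).hom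

lemma res_constHom {X : Scheme.{0}} (s : X ⟶ specC) {U W : X.Opens} (h : W ≤ U) (c : ℂ) :
    res h (constHom s U c) = constHom s W c := by
  exact congr($(s.appLE_map le_top (homOfLE h).op) ((Scheme.ΓSpecIso (CommRingCat.of ℂ)).inv c))

lemma appLE_constHom {X Y : Scheme.{0}} (f : Y ⟶ X) (s : X ⟶ specC) {U : X.Opens} {W : Y.Opens}
    (h : W ≤ f ⁻¹ᵁ U) (c : ℂ) :
    (f.appLE U W h).hom (constHom s U c) = constHom (f ≫ s) W c := by
  exact congr($(f.appLE_comp_appLE s ⊤ U W le_top h) ((Scheme.ΓSpecIso (CommRingCat.of ℂ)).inv c))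

lemma fromSpec_comp_toSpecC {X : Scheme.{0}} (s : X ⟶ specC) {U : X.Opens} (hU : IsAffineOpen U) :
    hU.fromSpec ≫ s = Spec.map (CommRingCat.ofHom (constHom s U)) := by
  rw [← IsAffineOpen.SpecMap_appLE_fromSpec s (isAffineOpen_top _) hU le_top]
  rw [constHom, CommRingCat.ofHom_hom, Spec.map_comp, IsAffineOpen.fromSpec_top,
    Scheme.isoSpec_Spec_inv]

end Constants

section Fractions

open MvPolynomial

variable {lam mu nu : MvPolynomial (Fin 2) ℂ}

/-- The open subset `D₊(λ)` of `ℙ¹` for a linear form `λ`. -/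
abbrev linOpen (lam : MvPolynomial (Fin 2) ℂ) : P1.Opens := Proj.basicOpen grading lam

lemma isAffineOpen_linOpen (hlam : lam ∈ grading 1) : IsAffineOpen (linOpen lam) :=
  Proj.isAffineOpen_basicOpen grading lam hlam one_pos

/-- The degree-zero fraction `μ / λ` of linear forms. -/
def awayFrac (hlam : lam ∈ grading 1) (hmu : mu ∈ grading 1) :
    HomogeneousLocalization.Away grading lam :=
  HomogeneousLocalization.Away.mk grading hlam 1 mu (by simpa using hmu)

/-- The function `μ / λ` on `D₊(λ)` for linear forms `λ` and `μ`. -/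
def frac (hlam : lam ∈ grading 1) (hmu : mu ∈ grading 1) : Γ(P1, linOpen lam) :=
  (Proj.awayToSection grading lam).hom (awayFrac hlam hmu)

lemma X_mem_grading (i : Fin 2) : (X i : MvPolynomial (Fin 2) ℂ) ∈ grading 1 :=
  isHomogeneous_X ℂ i

lemma frac_self (hlam : lam ∈ grading 1) : frac hlam hlam = 1 := by
  have : awayFrac hlam hlam = 1 := by
    apply HomogeneousLocalization.val_injective
    rw [awayFrac, HomogeneousLocalization.Away.val_mk, HomogeneousLocalization.val_one]
    simp only [pow_one]
    exact Localization.mk_self (⟨lam, _⟩ : Submonoid.powers lam)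
  rw [frac, this, map_one]

lemma frac_mul_frac (hlam : lam ∈ grading 1) (hmu : mu ∈ grading 1) (hnu : nu ∈ grading 1)
    {W : P1.Opens} (hW : W ≤ linOpen lam) (hW' : W ≤ linOpen mu) :
    res hW (frac hlam hmu) * res hW' (frac hmu hnu) = res hW (frac hlam hnu) := by
  have hW'' : W ≤ linOpen (lam * mu) := by
    change W ≤ Proj.basicOpen grading (lam * mu)
    rw [Proj.basicOpen_mul]
    exact le_inf hW hW'
  have h1 (ka : MvPolynomial (Fin 2) ℂ) (hka : ka ∈ grading 1) : res hW (frac hlam hka) =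
      res hW'' ((Proj.awayToSection grading (lam * mu)).hom
        (HomogeneousLocalization.awayMap grading hmu rfl (awayFrac hlam hka))) := by
    have := congr(res hW'' ($(Proj.awayMap_awayToSection grading (f := lam) hmu rfl)
      (awayFrac hlam hka)))
    refine Eq.trans ?_ this.symm
    exact (res_res _ _ _).symm
  have h2 : res hW' (frac hmu hnu) =
      res hW'' ((Proj.awayToSection grading (lam * mu)).hom
        (HomogeneousLocalization.awayMap grading hlam (mul_comm lam mu) (awayFrac hmu hnu))) := by
    have := congr(res hW'' ($(Proj.awayMap_awayToSection grading (f := mu) hlam (mul_comm lam mu))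
      (awayFrac hmu hnu)))
    refine Eq.trans ?_ this.symm
    exact (res_res _ _ _).symm
  rw [h1 mu hmu, h1 nu hnu, h2, ← map_mul, ← map_mul]
  congr 2
  apply HomogeneousLocalization.val_injective
  rw [HomogeneousLocalization.val_mul, awayFrac, awayFrac, awayFrac,
    HomogeneousLocalization.awayMap_mk, HomogeneousLocalization.awayMap_mk,
    HomogeneousLocalization.awayMap_mk, HomogeneousLocalization.Away.val_mk,
    HomogeneousLocalization.Away.val_mk, HomogeneousLocalization.Away.val_mk, Localization.mk_mul,
    Localization.mk_eq_mk_iff, Localization.r_iff_exists]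
  refine ⟨1, ?_⟩
  simp
  ring

lemma fromSpec_linOpen (hlam : lam ∈ grading 1) :
    (isAffineOpen_linOpen hlam).fromSpec = Spec.map (Proj.awayToSection grading lam) ≫
      Proj.awayι grading lam hlam one_pos := by
  rw [Proj.awayι, ← Category.assoc]
  change (isAffineOpen_linOpen hlam).isoSpec.inv ≫ _ = _
  congr 1
  rw [Iso.eq_comp_inv, Iso.inv_comp_eq, Proj.basicOpenIsoSpec_hom, Proj.basicOpenToSpec,
    IsAffineOpen.isoSpec_hom]

lemma constHom_linOpen (hlam : lam ∈ grading 1) (c : ℂ) :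
    constHom P1.toSpecC (linOpen lam) c = (Proj.awayToSection grading lam).hom
      (HomogeneousLocalization.fromZeroRingHom grading _ (algebraMap ℂ (grading 0) c)) := by
  have hD := isAffineOpen_linOpen hlam
  have h2 := fromSpec_comp_toSpecC P1.toSpecC hD
  rw [fromSpec_linOpen hlam, P1.toSpecC, Category.assoc, Proj.awayι_toSpecZero_assoc, ← Spec.map_comp,
    ← Spec.map_comp] at h2
  have h3 := Spec.map_injective h2
  exact congr($h3.symm c)

lemma val_fromZeroRingHom (c : ℂ) :
    (HomogeneousLocalization.fromZeroRingHom grading (Submonoid.powers lam)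
      (algebraMap ℂ (grading 0) c)).val =
      algebraMap (MvPolynomial (Fin 2) ℂ) _ (C c) := by
  exact Localization.mk_one_eq_algebraMap _

lemma val_awayFrac_mul (hlam : lam ∈ grading 1) (hmu : mu ∈ grading 1) :
    (awayFrac hlam hmu).val * algebraMap _ _ lam = algebraMap _ (Localization.Away lam) mu := by
  rw [awayFrac, HomogeneousLocalization.Away.val_mk, ← Localization.mk_one_eq_algebraMap,
    ← Localization.mk_one_eq_algebraMap, Localization.mk_mul, Localization.mk_eq_mk_iff,
    Localization.r_iff_exists]
  refine ⟨1, ?_⟩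
  simp
  ring

lemma eval₂_mul_pow_of_isHomogeneous {R : Type*} [CommRing R] (φ : ℂ →+* R) (y : Fin 2 → R) (t : R)
    {n : ℕ} {a : MvPolynomial (Fin 2) ℂ} (ha : a.IsHomogeneous n) :
    eval₂ φ y a * t ^ n = eval₂ φ (fun k => y k * t) a := by
  rw [eval₂_eq', eval₂_eq', Finset.sum_mul]
  refine Finset.sum_congr rfl fun d hd => ?_
  have hdeg : d.degree = n := by
    by_contra h
    exact (mem_support_iff.mp hd) (ha.coeff_eq_zero h)
  rw [mul_assoc, ← hdeg, Finsupp.degree_eq_sum, ← Finset.prod_pow_eq_pow_sum,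
    ← Finset.prod_mul_distrib]
  simp only [mul_pow]

/-- A degree-zero fraction is the value of its numerator at the fractions of the coordinates. -/
lemma away_mk_eq_eval₂ (hlam : lam ∈ grading 1) (n : ℕ) (a : MvPolynomial (Fin 2) ℂ)
    (ha : a ∈ grading (n • 1)) :
    HomogeneousLocalization.Away.mk grading hlam n a ha =
      eval₂ ((HomogeneousLocalization.fromZeroRingHom grading _).comp (algebraMap ℂ (grading 0)))
        (fun k => awayFrac hlam (X_mem_grading k)) a := by
  apply HomogeneousLocalization.val_injective
  rw [HomogeneousLocalization.Away.val_mk, ← HomogeneousLocalization.algebraMap_apply, hom_eval₂]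
  have hu : IsUnit (algebraMap _ (Localization.Away lam) lam ^ n) :=
    (IsLocalization.Away.algebraMap_isUnit lam).pow n
  rw [← hu.mul_left_inj]
  have hhom : a.IsHomogeneous n := by simpa using ha
  rw [eval₂_mul_pow_of_isHomogeneous _ _ _ hhom]
  have h1 : Localization.mk a (⟨lam ^ n, ⟨n, rfl⟩⟩ : Submonoid.powers lam) *
      algebraMap _ (Localization.Away lam) lam ^ n = algebraMap _ _ a := by
    rw [← map_pow, ← Localization.mk_one_eq_algebraMap, ← Localization.mk_one_eq_algebraMap,
      Localization.mk_mul, Localization.mk_eq_mk_iff, Localization.r_iff_exists]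
    refine ⟨1, ?_⟩
    simp
    ring
  refine h1.trans ?_
  conv_lhs => rw [← eval₂_eta a, hom_eval₂]
  congr 1
  funext k
  exact (val_awayFrac_mul hlam (X_mem_grading k)).symm

/-- The functions on `D₊(λ)` are generated by the constants and by `x₀ / λ` and `x₁ / λ`. -/
lemma subring_eq_top_of_frac_mem (hlam : lam ∈ grading 1) (S : Subring Γ(P1, linOpen lam))
    (hc : ∀ c, constHom P1.toSpecC (linOpen lam) c ∈ S)
    (hX : ∀ k, frac hlam (X_mem_grading k) ∈ S) : S = ⊤ := by
  rw [eq_top_iff]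
  intro z _
  obtain ⟨w, rfl⟩ : ∃ w, (Proj.awayToSection grading lam).hom w = z := by
    refine ⟨(Proj.basicOpenIsoAway grading lam hlam one_pos).inv.hom z, ?_⟩
    have := (Proj.basicOpenIsoAway grading lam hlam one_pos).inv_hom_id
    rw [Proj.basicOpenIsoAway_hom] at this
    exact congr($this z)
  obtain ⟨n, a, ha, rfl⟩ := HomogeneousLocalization.Away.mk_surjective grading hlam w
  rw [away_mk_eq_eval₂, eval₂_eq', map_sum]
  refine Subring.sum_mem _ fun d _ => ?_
  rw [map_mul, map_prod]
  refine Subring.mul_mem _ ?_ (Subring.prod_mem _ fun k _ => ?_)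
  · rw [RingHom.comp_apply, ← constHom_linOpen hlam]
    exact hc _
  · rw [map_pow]
    exact Subring.pow_mem _ (hX k) _

/-- A fraction is the value of its numerator at the fractions of the coordinates. -/
lemma frac_eq_sum (hlam : lam ∈ grading 1) (hmu : mu ∈ grading 1) :
    frac hlam hmu = eval₂ (constHom P1.toSpecC (linOpen lam))
      (fun k => frac hlam (X_mem_grading k)) mu := by
  rw [frac, awayFrac, away_mk_eq_eval₂, hom_eval₂]
  congr 1
  ext c
  exact (constHom_linOpen hlam c).symm

end Fractions

section Points

open MvPolynomial

variable {lam mu : MvPolynomial (Fin 2) ℂ}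

/-- Morphisms from an affine `ℂ`-scheme to `D₊(λ) ⊆ ℙ¹` agree if they pull the functions `x₀ / λ` and
`x₁ / λ` back to the same functions. -/
lemma hom_P1_ext (hlam : lam ∈ grading 1) {Y : Scheme.{0}} [IsAffine Y] (f g : Y ⟶ P1)
    (hf : ⊤ ≤ f ⁻¹ᵁ linOpen lam) (hg : ⊤ ≤ g ⁻¹ᵁ linOpen lam)
    (hfg : f ≫ P1.toSpecC = g ≫ P1.toSpecC)
    (h : ∀ k, (f.appLE _ ⊤ hf).hom (frac hlam (X_mem_grading k)) =
      (g.appLE _ ⊤ hg).hom (frac hlam (X_mem_grading k))) : f = g := by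
  have hD := isAffineOpen_linOpen hlam
  have hS := subring_eq_top_of_frac_mem hlam
    (RingHom.eqLocus (f.appLE _ ⊤ hf).hom (g.appLE _ ⊤ hg).hom)
    (fun c => by
      change (f.appLE _ ⊤ hf).hom _ = (g.appLE _ ⊤ hg).hom _
      rw [appLE_constHom, appLE_constHom, hfg]) h
  have hfg' : f.appLE _ ⊤ hf = g.appLE _ ⊤ hg := by
    ext z
    exact (hS ▸ Subring.mem_top z : z ∈ RingHom.eqLocus (f.appLE _ ⊤ hf).hom (g.appLE _ ⊤ hg).hom)
  have h1 := IsAffineOpen.SpecMap_appLE_fromSpec f hD (isAffineOpen_top Y) hf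
  have h2 := IsAffineOpen.SpecMap_appLE_fromSpec g hD (isAffineOpen_top Y) hg
  rw [hfg', h2, IsAffineOpen.fromSpec_top] at h1
  exact ((cancel_epi _).mp h1).symm

/-- For elements `c 0`, `c 1` of a `ℂ`-algebra `R` at which the linear form `λ` has the value `1`,
there is an `R`-valued point of `D₊(λ) ⊆ ℙ¹` with the homogeneous coordinates `c 0`, `c 1`. -/
lemma exists_point (hlam : lam ∈ grading 1) {R : Type} [CommRing R] (φ : ℂ →+* R) (c : Fin 2 → R)
    (hc : eval₂ φ c lam = 1) :
    ∃ (f : Spec (CommRingCat.of R) ⟶ P1) (hf : ⊤ ≤ f ⁻¹ᵁ linOpen lam),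
      f ≫ P1.toSpecC = Spec.map (CommRingCat.ofHom φ) ∧
      ∀ k, (f.appLE _ ⊤ hf).hom (frac hlam (X_mem_grading k)) =
        (Scheme.ΓSpecIso (CommRingCat.of R)).inv.hom (c k) := by
  have hD := isAffineOpen_linOpen hlam
  have hu : IsUnit (eval₂Hom φ c lam) := by simp [hc]
  let ψ : HomogeneousLocalization.Away grading lam →+* R :=
    (Localization.awayLift (eval₂Hom φ c) lam hu).comp (algebraMap _ _)
  have hψ (p) : Localization.awayLift (eval₂Hom φ c) lam hu (algebraMap _ _ p) = eval₂ φ c p :=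
    IsLocalization.Away.lift_eq lam hu p
  let χ : Γ(P1, linOpen lam) ⟶ CommRingCat.of R :=
    (Proj.basicOpenIsoAway grading lam hlam one_pos).inv ≫ CommRingCat.ofHom ψ
  have hχ (w) : χ.hom ((Proj.awayToSection grading lam).hom w) = ψ w := by
    have := (Proj.basicOpenIsoAway grading lam hlam one_pos).hom_inv_id
    rw [Proj.basicOpenIsoAway_hom] at this
    exact congr(ψ ($this w))
  have hχc (a : ℂ) : χ.hom (constHom P1.toSpecC (linOpen lam) a) = φ a := by
    rw [constHom_linOpen hlam, hχ]
    refine (congr(Localization.awayLift (eval₂Hom φ c) lam hu $(val_fromZeroRingHom a))).trans ?_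
    rw [hψ, eval₂_C]
  have hf : ⊤ ≤ (Spec.map χ ≫ hD.fromSpec) ⁻¹ᵁ linOpen lam := by
    rw [Scheme.Hom.comp_preimage, hD.fromSpec_preimage_self]
    exact le_rfl
  have happ : (Spec.map χ ≫ hD.fromSpec).appLE _ ⊤ hf =
      χ ≫ (Scheme.ΓSpecIso (CommRingCat.of R)).inv := by
    apply Spec.map_injective
    rw [← cancel_mono hD.fromSpec, IsAffineOpen.SpecMap_appLE_fromSpec _ hD (isAffineOpen_top _) hf,
      IsAffineOpen.fromSpec_top, Scheme.isoSpec_Spec_inv, ← Category.assoc, ← Spec.map_comp]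
  refine ⟨Spec.map χ ≫ hD.fromSpec, hf, ?_, fun k => ?_⟩
  · rw [Category.assoc, fromSpec_comp_toSpecC, ← Spec.map_comp]
    congr 1
    ext a
    exact hχc a
  · rw [happ]
    change (Scheme.ΓSpecIso (CommRingCat.of R)).inv.hom (χ.hom _) = _
    rw [frac, hχ]
    congr 1
    have h1 := congr(Localization.awayLift (eval₂Hom φ c) lam hu
      $(val_awayFrac_mul hlam (X_mem_grading k)))
    rw [map_mul, hψ, hψ, hc, mul_one, eval₂_X] at h1
    exact h1

end Points

/-! ### Affine open subsets of the product -/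

section FracAt

variable {lam mu nu : MvPolynomial (Fin 2) ℂ}

/-- The pullback of the function `μ / λ` to an open subset of a scheme over `ℙ¹`. -/
def fracAt {Y : Scheme.{0}} (f : Y ⟶ P1) (hlam : lam ∈ grading 1) (hmu : mu ∈ grading 1)
    {W : Y.Opens} (hW : W ≤ f ⁻¹ᵁ linOpen lam) : Γ(Y, W) :=
  (f.appLE (linOpen lam) W hW).hom (frac hlam hmu)

variable {Y : Scheme.{0}} (f : Y ⟶ P1) (hlam : lam ∈ grading 1) (hmu : mu ∈ grading 1)
  (hnu : nu ∈ grading 1)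

lemma res_fracAt {W T : Y.Opens} (hW : W ≤ f ⁻¹ᵁ linOpen lam) (h : T ≤ W) :
    res h (fracAt f hlam hmu hW) = fracAt f hlam hmu (h.trans hW) :=
  congr($(f.appLE_map hW (homOfLE h).op) (frac hlam hmu))

lemma appLE_fracAt {T : Scheme.{0}} (g : T ⟶ Y) {W : Y.Opens} {W' : T.Opens}
    (hW : W ≤ f ⁻¹ᵁ linOpen lam) (h : W' ≤ g ⁻¹ᵁ W) :
    (g.appLE W W' h).hom (fracAt f hlam hmu hW) =
      fracAt (g ≫ f) hlam hmu (h.trans (g.preimage_mono hW)) :=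
  congr($(g.appLE_comp_appLE f _ W W' hW h) (frac hlam hmu))

lemma app_fracAt {T : Scheme.{0}} (g : T ⟶ Y) {W : Y.Opens} (hW : W ≤ f ⁻¹ᵁ linOpen lam) :
    (g.app W).hom (fracAt f hlam hmu hW) =
      fracAt (g ≫ f) hlam hmu (g.preimage_mono hW) := by
  rw [← appLE_fracAt f hlam hmu g hW le_rfl, Scheme.Hom.appLE_eq_app]

lemma fracAt_self {W : Y.Opens} (hW : W ≤ f ⁻¹ᵁ linOpen lam) : fracAt f hlam hlam hW = 1 := by
  rw [fracAt, frac_self, map_one]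

lemma fracAt_mul {W : Y.Opens} (hW : W ≤ f ⁻¹ᵁ linOpen lam) (hW' : W ≤ f ⁻¹ᵁ linOpen mu) :
    fracAt f hlam hmu hW * fracAt f hmu hnu hW' = fracAt f hlam hnu hW := by
  have h := congr((f.appLE (linOpen lam ⊓ linOpen mu) W (le_inf hW hW')).hom
    $(frac_mul_frac hlam hmu hnu (W := linOpen lam ⊓ linOpen mu) inf_le_left inf_le_right))
  rw [map_mul] at h
  have key {ka : MvPolynomial (Fin 2) ℂ} (hka : ka ∈ grading 1) {ta : MvPolynomial (Fin 2) ℂ}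
      (hta : ta ∈ grading 1) (hle : linOpen lam ⊓ linOpen mu ≤ linOpen ka) :
      (f.appLE (linOpen lam ⊓ linOpen mu) W (le_inf hW hW')).hom (res hle (frac hka hta)) =
        fracAt f hka hta ((le_inf hW hW').trans (f.preimage_mono hle)) :=
    congr($(f.map_appLE (le_inf hW hW') (homOfLE hle).op) (frac hka hta))
  rwa [key, key, key] at h

lemma isUnit_fracAt {W : Y.Opens} (hW : W ≤ f ⁻¹ᵁ linOpen lam) (hW' : W ≤ f ⁻¹ᵁ linOpen mu) :
    IsUnit (fracAt f hlam hmu hW) :=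
  IsUnit.of_mul_eq_one (fracAt f hmu hlam hW') (by rw [fracAt_mul, fracAt_self])

lemma basicOpen_frac : P1.basicOpen (frac hlam hmu) = linOpen lam ⊓ linOpen mu := by
  have hD := isAffineOpen_linOpen hlam
  have hpre : hD.fromSpec ⁻¹ᵁ linOpen mu = hD.fromSpec ⁻¹ᵁ P1.basicOpen (frac hlam hmu) := by
    rw [hD.fromSpec_preimage_basicOpen, fromSpec_linOpen hlam, Scheme.Hom.comp_preimage,
      Proj.awayι_preimage_basicOpen grading hlam one_pos hmu one_pos]
    have : HomogeneousLocalization.Away.isLocalizationElem hlam hmu = awayFrac hlam hmu := by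
      apply HomogeneousLocalization.val_injective
      rw [awayFrac, HomogeneousLocalization.Away.val_mk, HomogeneousLocalization.Away.val_mk,
        pow_one]
    rw [this]
    rfl
  refine le_antisymm (fun x hx => ?_) (fun x hx => ?_)
  all_goals
    have hxl : x ∈ linOpen lam := by
      first
      | exact P1.basicOpen_le _ hx
      | exact hx.1
    obtain ⟨z, rfl⟩ : x ∈ Set.range hD.fromSpec := by rwa [hD.range_fromSpec]
  · exact ⟨hxl, (hpre ▸ hx : z ∈ hD.fromSpec ⁻¹ᵁ linOpen mu)⟩
  · exact (hpre ▸ hx.2 : z ∈ hD.fromSpec ⁻¹ᵁ P1.basicOpen (frac hlam hmu))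

lemma basicOpen_fracAt {W : Y.Opens} (hW : W ≤ f ⁻¹ᵁ linOpen lam) :
    Y.basicOpen (fracAt f hlam hmu hW) = W ⊓ f ⁻¹ᵁ linOpen mu := by
  have h1 : fracAt f hlam hmu hW = res hW ((f.app _).hom (frac hlam hmu)) := rfl
  rw [h1, Scheme.basicOpen_res]
  have h2 := Scheme.preimage_basicOpen f (frac hlam hmu)
  change W ⊓ Y.basicOpen (f.app _ (frac hlam hmu)) = _
  rw [← h2, basicOpen_frac]
  refine le_antisymm (inf_le_inf_left _ (f.preimage_mono inf_le_right)) (le_inf inf_le_left ?_)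
  exact fun x hx => ⟨hW hx.1, hx.2⟩

end FracAt

section Boxes

variable {lam mu : MvPolynomial (Fin 2) ℂ}

/-- The affine open subset `D₊(λ) × D₊(μ)` of `ℙ¹ × ℙ¹`. -/
abbrev box (lam mu : MvPolynomial (Fin 2) ℂ) : P1P1.Opens :=
  pr₁ ⁻¹ᵁ linOpen lam ⊓ pr₂ ⁻¹ᵁ linOpen mu

lemma pr₁_toSpecC : pr₁ ≫ P1.toSpecC = P1P1.toSpecC := rfl

lemma pr₂_toSpecC : pr₂ ≫ P1.toSpecC = P1P1.toSpecC := Limits.pullback.condition.symm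

lemma isAffineOpen_box (hlam : lam ∈ grading 1) (hmu : mu ∈ grading 1) :
    IsAffineOpen (box lam mu) := by
  have : IsAffine (linOpen lam).toScheme := isAffineOpen_linOpen hlam
  have : IsAffine (linOpen mu).toScheme := isAffineOpen_linOpen hmu
  let j := Limits.pullback.map ((linOpen lam).ι ≫ P1.toSpecC) ((linOpen mu).ι ≫ P1.toSpecC)
    P1.toSpecC P1.toSpecC (linOpen lam).ι (linOpen mu).ι (𝟙 _) (by simp) (by simp)
  have hj : box lam mu = j.opensRange := by
    ext1
    refine Eq.trans ?_ (Scheme.Pullback.range_map _ _ _ _ _ _ _ _ _).symm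
    rw [Scheme.Opens.range_ι, Scheme.Opens.range_ι]
    rfl
  rw [hj]
  exact isAffineOpen_opensRange j

lemma subring_eq_top_of_isPushout {A B C D : CommRingCat.{0}} {f : A ⟶ B} {g : A ⟶ C} {inl : B ⟶ D}
    {inr : C ⟶ D} (h : IsPushout f g inl inr) (S : Subring D) (h₁ : ∀ z, inl.hom z ∈ S)
    (h₂ : ∀ z, inr.hom z ∈ S) : S = ⊤ := by
  let l₁ : B ⟶ CommRingCat.of S := CommRingCat.ofHom (inl.hom.codRestrict S h₁)
  let l₂ : C ⟶ CommRingCat.of S := CommRingCat.ofHom (inr.hom.codRestrict S h₂)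
  let ρ : D ⟶ CommRingCat.of S := h.desc l₁ l₂ (by
    ext z
    exact congr($h.w z))
  have hρ : ρ ≫ CommRingCat.ofHom S.subtype = 𝟙 _ := by
    apply h.hom_ext
    · rw [← Category.assoc, h.inl_desc, Category.comp_id]
      rfl
    · rw [← Category.assoc, h.inr_desc, Category.comp_id]
      rfl
  rw [eq_top_iff]
  intro z _
  have hz : S.subtype (ρ.hom z) = z := congr($hρ z)
  rw [← hz]
  exact (ρ.hom z).2

/-- The functions on `D₊(λ) × D₊(μ)` are generated by the constants and by pulled back fractions. -/
lemma subring_eq_top_of_box (hlam : lam ∈ grading 1) (hmu : mu ∈ grading 1)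
    (S : Subring Γ(P1P1, box lam mu))
    (hc : ∀ c, constHom P1P1.toSpecC (box lam mu) c ∈ S)
    (h₁ : ∀ k, fracAt pr₁ hlam (X_mem_grading k) inf_le_left ∈ S)
    (h₂ : ∀ k, fracAt pr₂ hmu (X_mem_grading k) inf_le_right ∈ S) : S = ⊤ := by
  have hpb : IsPullback pr₁ pr₂ P1.toSpecC P1.toSpecC := IsPullback.of_hasPullback _ _
  have hpo := (isIso_pushoutSection_iff hpb (US := ⊤) (UT := linOpen mu) (UX := linOpen lam)
    (UY := box lam mu) le_top le_top rfl).mp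
    (isIso_pushoutSection_of_isAffineOpen _ _ _ _ (isAffineOpen_top _) (isAffineOpen_linOpen hmu)
      (isAffineOpen_linOpen hlam))
  have hr₁ (z) : (pr₁.appLE (linOpen lam) (box lam mu) inf_le_left).hom z ∈ S := by
    have := subring_eq_top_of_frac_mem hlam
      (S.comap (pr₁.appLE (linOpen lam) (box lam mu) inf_le_left).hom) (fun c => by
        rw [Subring.mem_comap, appLE_constHom, pr₁_toSpecC]
        exact hc c) h₁
    exact (this ▸ Subring.mem_top z : z ∈ S.comap _)
  have hr₂ (z) : (pr₂.appLE (linOpen mu) (box lam mu) inf_le_right).hom z ∈ S := by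
    have := subring_eq_top_of_frac_mem hmu
      (S.comap (pr₂.appLE (linOpen mu) (box lam mu) inf_le_right).hom) (fun c => by
        rw [Subring.mem_comap, appLE_constHom, pr₂_toSpecC]
        exact hc c) h₂
    exact (this ▸ Subring.mem_top z : z ∈ S.comap _)
  exact subring_eq_top_of_isPushout hpo S hr₁ hr₂

lemma exists_eq_pow_mul_res {X : Scheme.{0}} {U D : X.Opens} (hU : IsAffineOpen U) (φ : Γ(X, U))
    (hD : D = X.basicOpen φ) (hDU : D ≤ U) (f : Γ(X, D)) :
    ∃ (N : ℕ) (h : Γ(X, U)), res hDU h = res hDU φ ^ N * f := by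
  subst hD
  exact exists_eq_pow_mul_of_isCompact_of_isQuasiSeparated X U hU.isCompact hU.isQuasiSeparated φ f

end Boxes

section Charts

/-- The other index. -/
abbrev other (a : Fin 2) : Fin 2 := 1 - a

/-- The polynomial functions of the two affine coordinates on a standard chart. -/
def chartHom (p : Fin 2 × Fin 2) : MvPolynomial (Fin 2) ℂ →+* Γ(P1P1, chart p) :=
  MvPolynomial.eval₂Hom (constHom P1P1.toSpecC (chart p))
    ![fracAt pr₁ (X_mem_grading p.1) (X_mem_grading (other p.1)) inf_le_left,
      fracAt pr₂ (X_mem_grading p.2) (X_mem_grading (other p.2)) inf_le_right]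

lemma chartHom_surjective (p : Fin 2 × Fin 2) : Function.Surjective (chartHom p) := by
  rw [← RingHom.range_eq_top]
  refine subring_eq_top_of_box (X_mem_grading p.1) (X_mem_grading p.2) _ (fun c => ?_)
    (fun k => ?_) (fun k => ?_)
  · exact ⟨.C c, by simp [chartHom]⟩
  · by_cases hk : k = p.1
    · subst hk
      rw [fracAt_self]
      exact one_mem _
    · obtain rfl : k = other p.1 := by
        obtain ⟨a, b⟩ := p
        fin_cases a <;> fin_cases k <;> simp_all [other]
      exact ⟨.X 0, by simp [chartHom]⟩
  · by_cases hk : k = p.2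
    · subst hk
      rw [fracAt_self]
      exact one_mem _
    · obtain rfl : k = other p.2 := by
        obtain ⟨a, b⟩ := p
        fin_cases b <;> fin_cases k <;> simp_all [other]
      exact ⟨.X 1, by simp [chartHom]⟩

lemma transition_eq (m n : ℕ) (p q : Fin 2 × Fin 2) :
    transition m n p q =
      fracAt pr₁ (X_mem_grading p.1) (X_mem_grading q.1) inf_le_left ^ m *
        fracAt pr₂ (X_mem_grading p.2) (X_mem_grading q.2) inf_le_right ^ n := rfl

lemma isCocycle_transition (m n : ℕ) : IsCocycle (transition m n) where
  self p := by rw [transition_eq, fracAt_self, fracAt_self, one_pow, one_pow, one_mul]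
  trans p q r := by
    rw [transition_eq, transition_eq, transition_eq]
    simp only [map_mul, map_pow, res_fracAt]
    rw [← fracAt_mul pr₁ (X_mem_grading p.1) (X_mem_grading q.1) (X_mem_grading r.1) _
      (inf_le_right.trans inf_le_left),
      ← fracAt_mul pr₂ (X_mem_grading p.2) (X_mem_grading q.2) (X_mem_grading r.2) _
      (inf_le_right.trans inf_le_right)]
    ring

end Charts

/-! ### Laurent expansions on the torus -/

section SpecHom

variable {R : Type} [CommRing R] {X Y : Scheme.{0}}

/-- Pullback of functions on `U` along an `R`-valued point of `U`. -/
def specHom (f : Spec (CommRingCat.of R) ⟶ Y) (U : Y.Opens) (h : ⊤ ≤ f ⁻¹ᵁ U) : Γ(Y, U) →+* R :=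
  (f.appLE U ⊤ h ≫ (Scheme.ΓSpecIso (CommRingCat.of R)).hom).hom

lemma specHom_res (f : Spec (CommRingCat.of R) ⟶ Y) {U W : Y.Opens} (h : ⊤ ≤ f ⁻¹ᵁ W)
    (hWU : W ≤ U) (z : Γ(Y, U)) :
    specHom f W h (res hWU z) = specHom f U (h.trans (f.preimage_mono hWU)) z :=
  congr((Scheme.ΓSpecIso (CommRingCat.of R)).hom.hom ($(f.map_appLE h (homOfLE hWU).op) z))

lemma specHom_comp (f : Spec (CommRingCat.of R) ⟶ Y) (g : Y ⟶ X) {U : X.Opens} {W : Y.Opens}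
    (h : ⊤ ≤ f ⁻¹ᵁ W) (hW : W ≤ g ⁻¹ᵁ U) (h' : ⊤ ≤ (f ≫ g) ⁻¹ᵁ U) (z : Γ(X, U)) :
    specHom f W h ((g.appLE U W hW).hom z) = specHom (f ≫ g) U h' z :=
  congr((Scheme.ΓSpecIso (CommRingCat.of R)).hom.hom ($(f.appLE_comp_appLE g _ _ _ hW h) z))

lemma specHom_constHom (f : Spec (CommRingCat.of R) ⟶ Y) (s : Y ⟶ specC) (φ : ℂ →+* R)
    (hs : f ≫ s = Spec.map (CommRingCat.ofHom φ)) {U : Y.Opens} (h : ⊤ ≤ f ⁻¹ᵁ U) (c : ℂ) :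
    specHom f U h (constHom s U c) = φ c := by
  have h1 : (f.appLE U ⊤ h).hom (constHom s U c) = _ := appLE_constHom _ _ _ _
  rw [hs] at h1
  refine (congr((Scheme.ΓSpecIso (CommRingCat.of R)).hom.hom $h1)).trans ?_
  have h3 := Scheme.ΓSpecIso_naturality (CommRingCat.ofHom φ)
  rw [← Iso.inv_comp_eq] at h3
  have h4 : (Spec.map (CommRingCat.ofHom φ)).appLE ⊤ ⊤ le_top =
      (Spec.map (CommRingCat.ofHom φ)).appTop := Scheme.Hom.appLE_eq_app _
  rw [← h4] at h3
  exact congr($h3 c)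

/-- The point of `exists_point`, in terms of `specHom`. -/
lemma specHom_frac_of_exists_point {lam : MvPolynomial (Fin 2) ℂ} (hlam : lam ∈ grading 1)
    (φ : ℂ →+* R) (c : Fin 2 → R) (hc : MvPolynomial.eval₂ φ c lam = 1) :
    ∃ (f : Spec (CommRingCat.of R) ⟶ P1) (hf : ⊤ ≤ f ⁻¹ᵁ linOpen lam),
      f ≫ P1.toSpecC = Spec.map (CommRingCat.ofHom φ) ∧
      ∀ k, specHom f _ hf (frac hlam (X_mem_grading k)) = c k := by
  obtain ⟨f, hf, hfc, h⟩ := exists_point hlam φ c hc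
  refine ⟨f, hf, hfc, fun k => ?_⟩
  refine (congr((Scheme.ΓSpecIso (CommRingCat.of R)).hom.hom $(h k))).trans ?_
  exact congr($((Scheme.ΓSpecIso (CommRingCat.of R)).inv_hom_id) (c k))

end SpecHom

section Torus

/-- The ring of Laurent polynomials in two variables. -/
abbrev Laurent : Type := AddMonoidAlgebra ℂ (ℤ × ℤ)

/-- The Laurent monomial with exponents `e`. -/
def Laurent.mono (e : ℤ × ℤ) : Laurent := AddMonoidAlgebra.single e 1

lemma Laurent.mono_mul (e e' : ℤ × ℤ) : mono e * mono e' = mono (e + e') := by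
  rw [mono, mono, mono, AddMonoidAlgebra.single_mul_single, one_mul]

lemma Laurent.mono_zero : mono 0 = 1 := rfl

lemma Laurent.mono_pow (e : ℤ × ℤ) (k : ℕ) : mono e ^ k = mono (k • e) := by
  rw [mono, mono, AddMonoidAlgebra.single_pow, one_pow]

lemma Laurent.isUnit_mono (e : ℤ × ℤ) : IsUnit (mono e) :=
  IsUnit.of_mul_eq_one (mono (-e)) (by rw [mono_mul, add_neg_cancel, mono_zero])

lemma Laurent.algebraMap_mul_mono (c : ℂ) (e : ℤ × ℤ) :
    algebraMap ℂ Laurent c * mono e = AddMonoidAlgebra.single e c := by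
  rw [mono, ← Algebra.smul_def, AddMonoidAlgebra.smul_single, smul_eq_mul, mul_one]

/-- The inclusion of `Spec ℂ[x^±1, y^±1]` followed by a projection, `(1 : x)` or `(1 : y)`
according to `e`. -/
lemma exists_torus_point (e : ℤ × ℤ) : ∃ (f : Spec (CommRingCat.of Laurent) ⟶ P1)
    (hf : ∀ a, ⊤ ≤ f ⁻¹ᵁ linOpen (.X a)),
    f ≫ P1.toSpecC = Spec.map (CommRingCat.ofHom (algebraMap ℂ Laurent)) ∧
    ∀ a k : Fin 2, specHom f _ (hf a) (frac (X_mem_grading a) (X_mem_grading k)) =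
      Laurent.mono (((k : ℤ) - (a : ℤ)) • e) := by
  obtain ⟨f, hf, hfc, hfX⟩ := specHom_frac_of_exists_point (X_mem_grading 0)
    (algebraMap ℂ Laurent) ![1, Laurent.mono e] (by simp)
  have h0 (k : Fin 2) : specHom f _ hf (frac (X_mem_grading 0) (X_mem_grading k)) =
      Laurent.mono ((k : ℤ) • e) := by
    rw [hfX]
    fin_cases k
    · simp [Laurent.mono_zero]
    · simp
  -- The point also lies in `D₊(x₁)`, because `x₁ / x₀` has an invertible value.
  have hf1 : ⊤ ≤ f ⁻¹ᵁ linOpen (.X 1) := by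
    have hu : IsUnit (fracAt f (X_mem_grading 0) (X_mem_grading 1) hf) := by
      have h1 : IsUnit ((Scheme.ΓSpecIso (CommRingCat.of Laurent)).hom.hom
          (fracAt f (X_mem_grading 0) (X_mem_grading 1) hf)) := by
        have : _ = Laurent.mono _ := h0 1
        exact (congr(IsUnit $this)).mpr (Laurent.isUnit_mono _)
      have h2 := h1.map (Scheme.ΓSpecIso (CommRingCat.of Laurent)).inv.hom
      have h3 := congr($((Scheme.ΓSpecIso (CommRingCat.of Laurent)).hom_inv_id)
        (fracAt f (X_mem_grading 0) (X_mem_grading 1) hf))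
      exact (congr(IsUnit $h3)).mp h2
    have := basicOpen_fracAt f (X_mem_grading 0) (X_mem_grading 1) hf
    rw [Scheme.basicOpen_of_isUnit _ hu, top_inf_eq] at this
    exact this.le
  have hfa : ∀ a, ⊤ ≤ f ⁻¹ᵁ linOpen (.X a) := by
    intro a
    fin_cases a
    exacts [hf, hf1]
  refine ⟨f, hfa, hfc, fun a k => ?_⟩
  have h1 := congr((Scheme.ΓSpecIso (CommRingCat.of Laurent)).hom.hom
    $(fracAt_mul f (X_mem_grading 0) (X_mem_grading a) (X_mem_grading k) hf (hfa a)))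
  rw [map_mul] at h1
  change specHom f _ hf (frac (X_mem_grading 0) (X_mem_grading a)) *
    specHom f _ (hfa a) (frac (X_mem_grading a) (X_mem_grading k)) =
    specHom f _ hf (frac (X_mem_grading 0) (X_mem_grading k)) at h1
  rw [h0, h0] at h1
  rw [← (Laurent.isUnit_mono ((a : ℤ) • e)).mul_right_inj, h1, Laurent.mono_mul, ← add_smul,
    add_sub_cancel]

/-- The inclusion of the torus `Spec ℂ[x^±1, y^±1]` in `ℙ¹ × ℙ¹`. -/
def torus : Spec (CommRingCat.of Laurent) ⟶ P1P1 :=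
  Limits.pullback.lift (exists_torus_point (1, 0)).choose (exists_torus_point (0, 1)).choose
    ((exists_torus_point (1, 0)).choose_spec.choose_spec.1.trans
      (exists_torus_point (0, 1)).choose_spec.choose_spec.1.symm)

lemma torus_pr₁ : torus ≫ pr₁ = (exists_torus_point (1, 0)).choose :=
  Limits.pullback.lift_fst _ _ _

lemma torus_pr₂ : torus ≫ pr₂ = (exists_torus_point (0, 1)).choose :=
  Limits.pullback.lift_snd _ _ _

lemma torus_toSpecC :
    torus ≫ P1P1.toSpecC = Spec.map (CommRingCat.ofHom (algebraMap ℂ Laurent)) := by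
  rw [← pr₁_toSpecC, ← Category.assoc, torus_pr₁]
  exact (exists_torus_point (1, 0)).choose_spec.choose_spec.1

lemma top_le_torus_linOpen₁ (a : Fin 2) : ⊤ ≤ (torus ≫ pr₁) ⁻¹ᵁ linOpen (.X a) := by
  rw [torus_pr₁]
  exact (exists_torus_point (1, 0)).choose_spec.choose a

lemma top_le_torus_linOpen₂ (a : Fin 2) : ⊤ ≤ (torus ≫ pr₂) ⁻¹ᵁ linOpen (.X a) := by
  rw [torus_pr₂]
  exact (exists_torus_point (0, 1)).choose_spec.choose a

lemma top_le_torus_chart (p : Fin 2 × Fin 2) : ⊤ ≤ torus ⁻¹ᵁ chart p :=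
  fun _ hz => ⟨top_le_torus_linOpen₁ p.1 hz, top_le_torus_linOpen₂ p.2 hz⟩

/-- The Laurent expansion of functions on an open subset of `ℙ¹ × ℙ¹` which contains the torus. -/
def expand {U : P1P1.Opens} (h : ⊤ ≤ torus ⁻¹ᵁ U) : Γ(P1P1, U) →+* Laurent :=
  specHom torus U h

lemma expand_res {U W : P1P1.Opens} (h : ⊤ ≤ torus ⁻¹ᵁ W) (hWU : W ≤ U) (f : Γ(P1P1, U)) :
    expand h (res hWU f) = expand (h.trans (torus.preimage_mono hWU)) f :=
  specHom_res _ _ _ _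

lemma expand_constHom {U : P1P1.Opens} (h : ⊤ ≤ torus ⁻¹ᵁ U) (c : ℂ) :
    expand h (constHom P1P1.toSpecC U c) = algebraMap ℂ Laurent c :=
  specHom_constHom _ _ _ torus_toSpecC _ _

lemma expand_fracAt₁ {U : P1P1.Opens} (h : ⊤ ≤ torus ⁻¹ᵁ U) (a k : Fin 2)
    (hU : U ≤ pr₁ ⁻¹ᵁ linOpen (.X a)) :
    expand h (fracAt pr₁ (X_mem_grading a) (X_mem_grading k) hU) =
      Laurent.mono ((k : ℤ) - (a : ℤ), 0) := by
  refine (specHom_comp torus pr₁ h hU (top_le_torus_linOpen₁ a) _).trans ?_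
  have := (exists_torus_point (1, 0)).choose_spec.choose_spec.2 a k
  simp only [torus_pr₁]
  rw [this]
  simp

lemma expand_fracAt₂ {U : P1P1.Opens} (h : ⊤ ≤ torus ⁻¹ᵁ U) (a k : Fin 2)
    (hU : U ≤ pr₂ ⁻¹ᵁ linOpen (.X a)) :
    expand h (fracAt pr₂ (X_mem_grading a) (X_mem_grading k) hU) =
      Laurent.mono (0, (k : ℤ) - (a : ℤ)) := by
  refine (specHom_comp torus pr₂ h hU (top_le_torus_linOpen₂ a) _).trans ?_
  have := (exists_torus_point (0, 1)).choose_spec.choose_spec.2 a k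
  simp only [torus_pr₂]
  rw [this]
  simp

/-- The exponents in the Laurent expansion of a monomial in the coordinates of a chart. -/
def chartExp (p : Fin 2 × Fin 2) (d : Fin 2 →₀ ℕ) : ℤ × ℤ :=
  (d 0 * (((other p.1 : Fin 2) : ℤ) - (p.1 : ℤ)), d 1 * (((other p.2 : Fin 2) : ℤ) - (p.2 : ℤ)))

lemma chartExp_injective (p : Fin 2 × Fin 2) : Function.Injective (chartExp p) := by
  intro d d' h
  obtain ⟨a, b⟩ := p
  simp only [chartExp, Prod.mk.injEq] at h
  ext k
  fin_cases k
  · have := h.1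
    fin_cases a <;> simpa [other] using this
  · have := h.2
    fin_cases b <;> simpa [other] using this

lemma expand_chartHom (p : Fin 2 × Fin 2) (P : MvPolynomial (Fin 2) ℂ) :
    expand (top_le_torus_chart p) (chartHom p P) =
      ∑ d ∈ P.support, AddMonoidAlgebra.single (chartExp p d) (P.coeff d) := by
  rw [chartHom, MvPolynomial.coe_eval₂Hom, MvPolynomial.hom_eval₂, MvPolynomial.eval₂_eq']
  refine Finset.sum_congr rfl fun d _ => ?_
  rw [Fin.prod_univ_two, RingHom.comp_apply, expand_constHom, Matrix.cons_val_zero, Matrix.cons_val_one, Matrix.cons_val_fin_one, expand_fracAt₁,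
    expand_fracAt₂, Laurent.mono_pow, Laurent.mono_pow, Laurent.mono_mul,
    Laurent.algebraMap_mul_mono]
  simp [chartExp]

/-- Distinct monomials in the coordinates of a chart have distinct exponents, so that functions on the
chart are determined by their expansions. -/
lemma expand_chart_injective (p : Fin 2 × Fin 2) :
    Function.Injective (expand (top_le_torus_chart p)) := by
  rw [injective_iff_map_eq_zero]
  intro f hf
  obtain ⟨P, rfl⟩ := chartHom_surjective p f
  rw [expand_chartHom] at hf
  have : P = 0 := by
    ext d
    have h1 := congr(($hf).coeff (chartExp p d))
    rw [AddMonoidAlgebra.coeff_sum, Finsupp.finsetSum_apply] at h1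
    simp only [AddMonoidAlgebra.coeff_single, Finsupp.single_apply,
      (chartExp_injective p).eq_iff] at h1
    simpa using h1
  rw [this, map_zero]

end Torus

/-! ### Sections of the line bundles on the product -/

section ChartOverlaps

lemma chart_inf_chart (p q : Fin 2 × Fin 2) : chart p ⊓ chart q = P1P1.basicOpen
    (fracAt pr₁ (X_mem_grading p.1) (X_mem_grading q.1) (inf_le_left : chart p ≤ _) *
      fracAt pr₂ (X_mem_grading p.2) (X_mem_grading q.2) (inf_le_right : chart p ≤ _)) := by
  rw [Scheme.basicOpen_mul, basicOpen_fracAt, basicOpen_fracAt, ← inf_inf_distrib_left]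

/-- The exponent of the Laurent expansion of the transition function of `𝒪(1, 1)`. -/
def shift (p q : Fin 2 × Fin 2) : ℤ × ℤ :=
  (((q.1 : ℕ) : ℤ) - (p.1 : ℕ), ((q.2 : ℕ) : ℤ) - (p.2 : ℕ))

/-- A function on the overlap of two charts extends to the first one after multiplication by a power of
the transition function of `𝒪(1, 1)`. -/
lemma exists_expand_eq_mul {p q : Fin 2 × Fin 2} {D : P1P1.Opens} (hD : D = chart p ⊓ chart q)
    (hT : ⊤ ≤ torus ⁻¹ᵁ D) (f : Γ(P1P1, D)) :
    ∃ (N : ℕ) (h : Γ(P1P1, chart p)), (h = 0 → f = 0) ∧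
      expand (top_le_torus_chart p) h = Laurent.mono (N • shift p q) * expand hT f := by
  have hDp : D ≤ chart p := hD.le.trans inf_le_left
  have hDq : D ≤ chart q := hD.le.trans inf_le_right
  obtain ⟨N, h, hh⟩ := exists_eq_pow_mul_res (isAffineOpen_box (X_mem_grading p.1)
    (X_mem_grading p.2)) _ (hD.trans (chart_inf_chart p q)) hDp f
  refine ⟨N, h, fun h0 => ?_, ?_⟩
  · rw [h0, map_zero, map_mul, res_fracAt, res_fracAt] at hh
    have hu := ((isUnit_fracAt pr₁ (X_mem_grading p.1) (X_mem_grading q.1)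
      (hDp.trans inf_le_left) (hDq.trans inf_le_left)).mul
      (isUnit_fracAt pr₂ (X_mem_grading p.2) (X_mem_grading q.2)
      (hDp.trans inf_le_right) (hDq.trans inf_le_right))).pow N
    exact hu.mul_right_eq_zero.mp hh.symm
  · have := congr(expand hT $hh)
    rw [expand_res, map_mul, map_mul, map_pow, map_mul, res_fracAt, res_fracAt, expand_fracAt₁,
      expand_fracAt₂, Laurent.mono_mul, Laurent.mono_pow] at this
    rw [this]
    simp [shift]

lemma expand_injective {p q : Fin 2 × Fin 2} {D : P1P1.Opens} (hD : D = chart p ⊓ chart q)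
    (hT : ⊤ ≤ torus ⁻¹ᵁ D) : Function.Injective (expand hT) := by
  rw [injective_iff_map_eq_zero]
  intro f hf
  obtain ⟨N, h, h0, hh⟩ := exists_expand_eq_mul hD hT f
  rw [hf, mul_zero] at hh
  exact h0 ((injective_iff_map_eq_zero _).mp (expand_chart_injective p) h hh)

lemma expand_transition {U : P1P1.Opens} (hT : ⊤ ≤ torus ⁻¹ᵁ U) (m n : ℕ) (p q : Fin 2 × Fin 2)
    (hU : U ≤ chart p) : expand hT (res hU (transition m n p q)) =
      Laurent.mono (m * (shift p q).1, n * (shift p q).2) := by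
  rw [expand_res, transition_eq, map_mul, map_pow, map_pow, expand_fracAt₁, expand_fracAt₂,
    Laurent.mono_pow, Laurent.mono_pow, Laurent.mono_mul]
  simp [shift]

end ChartOverlaps

section LineBundle

variable {m n : ℕ}

/-- The sections of `𝒪(m, n)`, the ideal sheaf of the empty subscheme twisted by `(m, n)`. -/
abbrev lineSections (m n : ℕ) (U : P1P1.Opens) : AddSubgroup (∀ p, Γ(P1P1, U ⊓ chart p)) :=
  twistSections (Scheme.emptyTo P1P1) chart (transition m n) U

/-- The line bundle `𝒪(m, n)`. -/
abbrev lineBundle (m n : ℕ) : TopCat.Sheaf AddCommGrpCat.{0} P1P1 :=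
  twistSheaf (Scheme.emptyTo P1P1) chart (transition m n)

lemma top_le_torus_inf {U : P1P1.Opens} (hU : ⊤ ≤ torus ⁻¹ᵁ U) (p : Fin 2 × Fin 2) :
    ⊤ ≤ torus ⁻¹ᵁ (U ⊓ chart p) :=
  fun _ hz => ⟨hU hz, top_le_torus_chart p hz⟩

/-- The Laurent expansion of a section of `𝒪(m, n)` in terms of the generator `x₀ ^ m * z₀ ^ n`. -/
def secExpand {U : P1P1.Opens} (hU : ⊤ ≤ torus ⁻¹ᵁ U) : lineSections m n U →+ Laurent where
  toFun s := expand (top_le_torus_inf hU (0, 0)) (s.1 (0, 0))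
  map_zero' := map_zero _
  map_add' _ _ := map_add _ _ _

lemma secExpand_twistRes {U W : P1P1.Opens} (hW : ⊤ ≤ torus ⁻¹ᵁ W) (h : W ≤ U)
    (s : lineSections m n U) :
    secExpand hW (twistRes _ _ _ h s) = secExpand (hW.trans (torus.preimage_mono h)) s :=
  expand_res _ _ _

/-- The exponent of the Laurent expansion of the generator of `𝒪(m, n)` over a standard chart. -/
def genExp (m n : ℕ) (p : Fin 2 × Fin 2) : ℤ × ℤ := (m * (p.1 : ℕ), n * (p.2 : ℕ))

/-- The expansion of a section in terms of its component at any chart. -/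
lemma secExpand_eq {U : P1P1.Opens} (hU : ⊤ ≤ torus ⁻¹ᵁ U) (s : lineSections m n U)
    (p : Fin 2 × Fin 2) : secExpand hU s =
      Laurent.mono (genExp m n p) * expand (top_le_torus_inf hU p) (s.1 p) := by
  have hT := top_le_torus_inf (top_le_torus_inf hU (0, 0)) p
  have := congr(expand hT $(twistSections_compat _ s (0, 0) p (W := U ⊓ chart (0, 0) ⊓ chart p)
    (inf_le_left.trans inf_le_left) (inf_le_left.trans inf_le_right) inf_le_right))
  rw [map_mul, expand_transition, expand_res, expand_res] at this
  refine this.trans ?_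
  simp [shift, genExp]

lemma secExpand_injective {U : P1P1.Opens} (hU : ⊤ ≤ torus ⁻¹ᵁ U)
    (hq : ∀ p, ∃ q, U ⊓ chart p = chart p ⊓ chart q) :
    Function.Injective (secExpand (m := m) (n := n) hU) := by
  rw [injective_iff_map_eq_zero]
  intro s hs
  apply Subtype.ext
  funext p
  obtain ⟨q, hq⟩ := hq p
  apply expand_injective hq (top_le_torus_inf hU p)
  rw [secExpand_eq hU s p, (Laurent.isUnit_mono _).mul_right_eq_zero] at hs
  exact hs.trans (map_zero _).symm

/-- The exponents of the sections of `𝒪(m, n)` over a standard chart. -/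
def inCone (m n : ℕ) (p : Fin 2 × Fin 2) (e : ℤ × ℤ) : Prop :=
  (if p.1 = 0 then 0 ≤ e.1 else e.1 ≤ m) ∧ (if p.2 = 0 then 0 ≤ e.2 else e.2 ≤ n)

lemma inCone_iff (m n : ℕ) (p : Fin 2 × Fin 2) (e : ℤ × ℤ) :
    inCone m n p e ↔ ∃ d, e = genExp m n p + chartExp p d := by
  obtain ⟨a, b⟩ := p
  obtain ⟨x, y⟩ := e
  simp only [inCone, genExp, chartExp, Prod.mk_add_mk, Prod.mk.injEq]
  constructor
  · rintro ⟨h1, h2⟩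
    refine ⟨Finsupp.equivFunOnFinite.symm ![(if a = 0 then x else m - x).toNat,
      (if b = 0 then y else n - y).toNat], ?_⟩
    fin_cases a <;> fin_cases b <;> simp_all [other]
  · rintro ⟨d, h1, h2⟩
    subst h1 h2
    fin_cases a <;> fin_cases b <;> simp [other]

/-- The expansion of a section over a chart has its exponents in the cone of the chart. -/
lemma inCone_of_expand {p : Fin 2 × Fin 2} (h : Γ(P1P1, chart p)) {e : ℤ × ℤ}
    (he : (expand (top_le_torus_chart p) h).coeff e ≠ 0) :
    inCone m n p (genExp m n p + e) := by
  obtain ⟨P, rfl⟩ := chartHom_surjective p h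
  rw [expand_chartHom, AddMonoidAlgebra.coeff_sum, Finsupp.finsetSum_apply] at he
  obtain ⟨d, -, hd⟩ := Finset.exists_ne_zero_of_sum_ne_zero he
  rw [AddMonoidAlgebra.coeff_single, Finsupp.single_apply, ne_eq, ite_eq_right_iff] at hd
  push Not at hd
  rw [inCone_iff]
  exact ⟨d, by rw [hd.1]⟩

lemma coeff_mono_mul (e e' : ℤ × ℤ) (f : Laurent) :
    (Laurent.mono e * f).coeff (e + e') = f.coeff e' := by
  simp [Laurent.mono]

/-- The exponents of sections over an overlap of charts `p` and `q` lie in the cone of `p` up to shifts in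
the direction of `q`. -/
lemma exists_inCone {U : P1P1.Opens} (hU : ⊤ ≤ torus ⁻¹ᵁ U) (s : lineSections m n U)
    {p q : Fin 2 × Fin 2} (hq : U ⊓ chart p = chart p ⊓ chart q) {e : ℤ × ℤ}
    (he : (secExpand hU s).coeff e ≠ 0) : ∃ N : ℕ, inCone m n p (e + N • shift p q) := by
  obtain ⟨N, h, -, hh⟩ := exists_expand_eq_mul hq (top_le_torus_inf hU p) (s.1 p)
  obtain ⟨e', rfl⟩ : ∃ e', e = genExp m n p + e' :=
    ⟨_, (add_sub_cancel _ _).symm⟩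
  rw [secExpand_eq hU s p, coeff_mono_mul] at he
  refine ⟨N, ?_⟩
  rw [add_assoc, add_comm e']
  apply inCone_of_expand h
  rwa [hh, coeff_mono_mul]

lemma exists_secExpand_chart {p : Fin 2 × Fin 2} {e : ℤ × ℤ} (he : inCone m n p e) (c : ℂ) :
    ∃ s : lineSections m n (chart p),
      secExpand (top_le_torus_chart p) s = AddMonoidAlgebra.single e c := by
  obtain ⟨d, rfl⟩ := (inCone_iff m n p e).mp he
  obtain ⟨s, hs⟩ := exists_twistSections (Scheme.emptyTo P1P1) (isCocycle_transition m n) p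
    (chartHom p (.monomial d c)) (Subsingleton.elim _ _)
  refine ⟨s, ?_⟩
  rw [secExpand_eq _ s p, hs, expand_res, expand_chartHom, Laurent.mono]
  by_cases hc : c = 0
  · simp [hc]
  · simp [MvPolynomial.support_monomial, hc]

/-- A monomial which is regular on several charts is a section over their union: the sections on the
charts glue because they have the same expansion. -/
lemma exists_secExpand_iSup {κ : Type} (r : κ → Fin 2 × Fin 2) {U : P1P1.Opens}
    (hU : ⊤ ≤ torus ⁻¹ᵁ U) (hUr : U = ⨆ k, chart (r k)) [Nonempty κ] {e : ℤ × ℤ}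
    (he : ∀ k, inCone m n (r k) e) (c : ℂ) :
    ∃ s : lineSections m n U, secExpand hU s = AddMonoidAlgebra.single e c := by
  subst hUr
  choose s hs using fun k => exists_secExpand_chart (he k) c
  obtain ⟨t, ht, -⟩ := (lineBundle m n).existsUnique_gluing' (fun k => chart (r k)) _
    (fun k => homOfLE (le_iSup (fun k => chart (r k)) k)) le_rfl s (by
      intro k k'
      apply twistSections_ext (p := r k) (Scheme.emptyTo P1P1) inf_le_left
      have hT := top_le_torus_inf (top_le_torus_chart (r k)) (r k')
      apply expand_injective (p := r k) (q := r k') (inf_eq_left.mpr inf_le_left)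
        (top_le_torus_inf hT (r k))
      have key {W : P1P1.Opens} (hW : ⊤ ≤ torus ⁻¹ᵁ W) (h : chart (r k) ⊓ chart (r k') ≤ W)
          (s : lineSections m n W) (hs : secExpand hW s = AddMonoidAlgebra.single e c) :
          Laurent.mono (genExp m n (r k)) *
            expand (top_le_torus_inf hT (r k)) ((twistRes _ _ _ h s).1 (r k)) =
          AddMonoidAlgebra.single e c := by
        rw [← secExpand_eq hT (twistRes _ _ _ h s) (r k), secExpand_twistRes, hs]
      exact (Laurent.isUnit_mono _).mul_right_injective ((key _ inf_le_left (s k) (hs k)).trans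
        (key _ inf_le_right (s k') (hs k')).symm))
  refine ⟨t, ?_⟩
  obtain ⟨k⟩ := ‹Nonempty κ›
  rw [← hs k, ← ht k]
  exact (secExpand_twistRes (top_le_torus_chart (r k))
    (le_iSup (fun k => chart (r k)) k) t).symm

/-- Two unions of charts on which `𝒪(m, n)` splits: each monomial in the Laurent expansion of a
section over the overlap is a section over one of them. -/
lemma splits_lineBundle {κ κ' : Type} [Nonempty κ] [Nonempty κ'] (r : κ → Fin 2 × Fin 2)
    (r' : κ' → Fin 2 × Fin 2) {U U' : P1P1.Opens} (hU : U = ⨆ k, chart (r k))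
    (hU' : U' = ⨆ k, chart (r' k)) (hq : ∀ p, ∃ q, U ⊓ U' ⊓ chart p = chart p ⊓ chart q)
    (hcone : ∀ e, (∀ p q, U ⊓ U' ⊓ chart p = chart p ⊓ chart q →
      ∃ N : ℕ, inCone m n p (e + N • shift p q)) →
      (∀ k, inCone m n (r k) e) ∨ ∀ k, inCone m n (r' k) e) :
    Splits (lineBundle m n) U U' := by
  obtain ⟨k⟩ := ‹Nonempty κ›
  obtain ⟨k'⟩ := ‹Nonempty κ'›
  have hT : ⊤ ≤ torus ⁻¹ᵁ U := (top_le_torus_chart (r k)).trans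
    (torus.preimage_mono (hU ▸ le_iSup (fun k => chart (r k)) k))
  have hT' : ⊤ ≤ torus ⁻¹ᵁ U' := (top_le_torus_chart (r' k')).trans
    (torus.preimage_mono (hU' ▸ le_iSup (fun k => chart (r' k)) k'))
  have hTT : ⊤ ≤ torus ⁻¹ᵁ (U ⊓ U') := fun _ hz => ⟨hT hz, hT' hz⟩
  intro (d : lineSections m n (U ⊓ U'))
  have hd : secExpand hTT d ∈ (secExpand (m := m) (n := n) hT).range ⊔
      (secExpand (m := m) (n := n) hT').range := by
    rw [← AddMonoidAlgebra.sum_coeff_single (secExpand hTT d)]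
    refine AddSubgroup.sum_mem _ fun e he => ?_
    rcases hcone e fun p q hpq => exists_inCone hTT d hpq (Finsupp.mem_support_iff.mp he) with h | h
    · have : Nonempty κ := ⟨k⟩
      exact AddSubgroup.mem_sup_left (exists_secExpand_iSup r hT hU h _)
    · have : Nonempty κ' := ⟨k'⟩
      exact AddSubgroup.mem_sup_right (exists_secExpand_iSup r' hT' hU' h _)
  obtain ⟨_, ⟨a, rfl⟩, _, ⟨b, rfl⟩, hab⟩ := AddSubgroup.mem_sup.mp hd
  refine ⟨a, -b, secExpand_injective hTT hq ?_⟩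
  rw [← hab]
  refine Eq.symm ((map_sub (secExpand hTT) (twistRes _ _ _ inf_le_left a)
    (twistRes _ _ _ inf_le_right (-b))).trans ?_)
  rw [secExpand_twistRes, secExpand_twistRes, map_neg, sub_neg_eq_add]

/-- On the overlap of two charts in a column, a monomial with first exponent `i` is regular on the first
chart if `0 ≤ i` and on the second one if `i ≤ m`. -/
lemma splits_lineBundle_chart (m n : ℕ) (b : Fin 2) :
    Splits (lineBundle m n) (chart (0, b)) (chart (1, b)) := by
  refine splits_lineBundle (κ := Unit) (κ' := Unit) (fun _ => (0, b)) (fun _ => (1, b))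
    iSup_const.symm iSup_const.symm (fun p => ⟨(other p.1, b), ?_⟩) fun e he => ?_
  · obtain ⟨a, b'⟩ := p
    ext x
    fin_cases a <;> fin_cases b' <;> fin_cases b <;> simp [other] <;> tauto
  · obtain ⟨N, h1, h2⟩ := he (0, b) (1, b) (by rw [inf_right_comm, inf_idem])
    by_cases h : 0 ≤ e.1
    · refine Or.inl fun _ => ⟨by simpa using h, ?_⟩
      simpa [shift] using h2
    · refine Or.inr fun _ => ⟨?_, ?_⟩
      · simp
        omega
      · simpa [shift] using h2

/-- On the overlap of the two columns, first exponents are between `0` and `m`, and a monomial with second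
exponent `j` is regular on the first column if `0 ≤ j` and on the second one if `j ≤ n`. -/
lemma splits_lineBundle_sup (m n : ℕ) :
    Splits (lineBundle m n) (chart (0, 0) ⊔ chart (1, 0)) (chart (0, 1) ⊔ chart (1, 1)) := by
  have hov (p : Fin 2 × Fin 2) : (chart (0, 0) ⊔ chart (1, 0)) ⊓ (chart (0, 1) ⊔ chart (1, 1)) ⊓
      chart p = chart p ⊓ chart (p.1, other p.2) := by
    obtain ⟨a, b⟩ := p
    ext x
    fin_cases a <;> fin_cases b <;> simp [other] <;> tauto
  refine splits_lineBundle (fun a : Fin 2 => (a, 0)) (fun a : Fin 2 => (a, 1))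
    ?_ ?_ (fun p => ⟨_, hov p⟩) fun e he => ?_
  · ext x
    simp [Fin.exists_fin_two]
    tauto
  · ext x
    simp [Fin.exists_fin_two]
    tauto
  · obtain ⟨N, h1, -⟩ := he (0, 0) _ (hov _)
    obtain ⟨M, h2, -⟩ := he (1, 0) _ (hov _)
    simp only [shift, sub_self, Prod.fst_add, Prod.smul_fst, smul_zero, add_zero] at h1 h2
    by_cases h : 0 ≤ e.2
    · refine Or.inl fun k => ?_
      fin_cases k
      · exact ⟨h1, by simpa using h⟩
      · exact ⟨h2, by simpa using h⟩
    · have h' : e.2 ≤ n := by omega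
      refine Or.inr fun k => ?_
      fin_cases k
      · exact ⟨h1, by simpa using h'⟩
      · exact ⟨h2, by simpa using h'⟩

lemma exists_mem_chart (x : P1) : ∃ a, x ∈ P1.chart a := by
  have := Proj.iSup_basicOpen_eq_top' grading (fun a : Fin 2 => MvPolynomial.X a)
    (fun a => ⟨1, X_mem_grading a⟩) ?_
  · exact Opens.mem_iSup.mp (this ▸ Opens.mem_top x)
  · rw [eq_top_iff]
    rintro P -
    induction P using MvPolynomial.induction_on with
    | C c =>
      exact Subalgebra.algebraMap_mem _
        (⟨MvPolynomial.C c, MvPolynomial.isHomogeneous_C _ c⟩ : grading 0)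
    | add P Q hP hQ => exact add_mem hP hQ
    | mul_X P a hP => exact mul_mem hP (Algebra.subset_adjoin ⟨a, rfl⟩)

lemma iSup_chart : ⨆ p, chart p = ⊤ := by
  rw [eq_top_iff]
  intro x _
  obtain ⟨a, ha⟩ := exists_mem_chart (pr₁ x)
  obtain ⟨b, hb⟩ := exists_mem_chart (pr₂ x)
  exact Opens.mem_iSup.mpr ⟨(a, b), ha, hb⟩

/-- The monomials of bidegree at most `(m, n)` are global sections of `𝒪(m, n)`. -/
lemma exists_secExpand_top {i j : ℕ} (hi : i ≤ m) (hj : j ≤ n) (c : ℂ) :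
    ∃ s : lineSections m n ⊤,
      secExpand le_top s = AddMonoidAlgebra.single ((i : ℤ), (j : ℤ)) c := by
  refine exists_secExpand_iSup id le_top iSup_chart.symm (fun p => ?_) c
  obtain ⟨a, b⟩ := p
  fin_cases a <;> fin_cases b <;> simp [inCone, hi, hj]

/-- The components of a monomial section. -/
lemma component_of_secExpand {i j : ℕ} (hi : i ≤ m) (hj : j ≤ n) {c : ℂ} {s : lineSections m n ⊤}
    (hs : secExpand le_top s = AddMonoidAlgebra.single ((i : ℤ), (j : ℤ)) c) (p : Fin 2 × Fin 2) :
    s.1 p = constHom P1P1.toSpecC _ c *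
      (fracAt pr₁ (X_mem_grading p.1) (X_mem_grading 0) (inf_le_right.trans inf_le_left) ^ (m - i) *
        fracAt pr₁ (X_mem_grading p.1) (X_mem_grading 1) (inf_le_right.trans inf_le_left) ^ i) *
      (fracAt pr₂ (X_mem_grading p.2) (X_mem_grading 0) (inf_le_right.trans inf_le_right) ^ (n - j) *
        fracAt pr₂ (X_mem_grading p.2) (X_mem_grading 1) (inf_le_right.trans inf_le_right) ^ j) := by
  obtain ⟨m, rfl⟩ := Nat.exists_eq_add_of_le' hi
  obtain ⟨n, rfl⟩ := Nat.exists_eq_add_of_le' hj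
  apply expand_injective (p := p) (q := p) (by rw [top_inf_eq, inf_idem])
    (top_le_torus_inf le_top p)
  rw [secExpand_eq le_top s p] at hs
  apply (Laurent.isUnit_mono (genExp _ _ p)).mul_right_injective
  refine hs.trans ?_
  simp only [map_mul, map_pow, expand_fracAt₁, expand_fracAt₂, expand_constHom, Laurent.mono_pow,
    Laurent.mono_mul]
  rw [mul_assoc, Laurent.mono_mul, mul_left_comm, Laurent.mono_mul, Laurent.algebraMap_mul_mono]
  congr 1
  ext
  · simp [genExp]
    ring
  · simp [genExp]
    ring

end LineBundle

/-! ### Restriction to a finite subscheme -/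

section FiniteSchemes

variable {Z : Scheme.{0}}

lemma exists_glue {U W : Z.Opens} (φ : Γ(Z, U)) (ψ : Γ(Z, W))
    (h : res (W := U ⊓ W) inf_le_left φ = res inf_le_right ψ) :
    ∃ χ : Γ(Z, U ⊔ W), res le_sup_left χ = φ ∧ res le_sup_right χ = ψ := by
  let U' : Bool → Z.Opens := fun c => bif c then U else W
  let sf : ∀ c, Γ(Z, U' c) := fun c =>
    match c with
    | true => φ
    | false => ψ
  obtain ⟨χ, hχ, -⟩ := Z.sheaf.existsUnique_gluing' U' (U ⊔ W)
    (fun c => homOfLE (by cases c; exacts [le_sup_right, le_sup_left]))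
    (sup_le (le_iSup U' true) (le_iSup U' false)) sf (by
      rintro (_ | _) (_ | _)
      · rfl
      · have := congr(res (le_of_eq (inf_comm W U)) $h)
        rw [res_res, res_res] at this
        exact this.symm
      · exact h
      · rfl)
  exact ⟨χ, hχ true, hχ false⟩

/-- On a discrete scheme, functions which agree on the overlap have a common global extension. -/
lemma exists_glue_top [DiscreteTopology Z] {U W : Z.Opens} (φ : Γ(Z, U)) (ψ : Γ(Z, W))
    (h : res (W := U ⊓ W) inf_le_left φ = res inf_le_right ψ) :
    ∃ χ : Γ(Z, ⊤), res le_top χ = φ ∧ res le_top χ = ψ := by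
  obtain ⟨χ, rfl, rfl⟩ := exists_glue φ ψ h
  obtain ⟨χ', hχ', -⟩ := exists_glue (W := ⟨(U ⊔ W : Z.Opens)ᶜ, isOpen_discrete _⟩) χ 0 (by
    refine res_ext (fun k : Empty => k.elim) (fun k => k.elim) ?_ fun k => k.elim
    intro x hx
    exact (hx.2 hx.1).elim)
  have htop : (⊤ : Z.Opens) ≤ (U ⊔ W) ⊔ ⟨(U ⊔ W : Z.Opens)ᶜ, isOpen_discrete _⟩ := by
    intro x _
    by_cases hx : x ∈ U ⊔ W
    · exact Or.inl hx
    · exact Or.inr hx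
  refine ⟨res htop χ', ?_, ?_⟩
  all_goals rw [← hχ', res_res, res_res]

end FiniteSchemes

section Traces

variable {m n : ℕ} {Z : Scheme.{0}} (i : Z ⟶ P1P1) {lam mu : MvPolynomial (Fin 2) ℂ}
  (hlam : lam ∈ grading 1) (hmu : mu ∈ grading 1) (hl : ⊤ ≤ (i ≫ pr₁) ⁻¹ᵁ linOpen lam)
  (hm : ⊤ ≤ (i ≫ pr₂) ⁻¹ᵁ linOpen mu)

/-- The function `(xᵢ / λ) ^ m * (zⱼ / μ) ^ n` on `Z`, where `p = (i, j)`: the generator of `𝒪(m, n)`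
over a standard chart in terms of the generator `λ ^ m * μ ^ n` along `Z`. -/
def weight (m n : ℕ) (p : Fin 2 × Fin 2) (W : Z.Opens) : Γ(Z, W) :=
  fracAt (i ≫ pr₁) hlam (X_mem_grading p.1) (le_top.trans hl) ^ m *
    fracAt (i ≫ pr₂) hmu (X_mem_grading p.2) (le_top.trans hm) ^ n

lemma res_weight (p : Fin 2 × Fin 2) {W W' : Z.Opens} (h : W' ≤ W) :
    res h (weight i hlam hmu hl hm m n p W) = weight i hlam hmu hl hm m n p W' := by
  rw [weight, weight, map_mul, map_pow, map_pow, res_fracAt, res_fracAt]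

lemma isUnit_weight {p : Fin 2 × Fin 2} {W : Z.Opens} (h : W ≤ i ⁻¹ᵁ chart p) :
    IsUnit (weight i hlam hmu hl hm m n p W) :=
  ((isUnit_fracAt _ _ _ _ (h.trans fun _ hz => hz.1)).pow m).mul
    ((isUnit_fracAt _ _ _ _ (h.trans fun _ hz => hz.2)).pow n)

lemma appLE_transition_mul_weight (p q : Fin 2 × Fin 2) {W : Z.Opens} (h : W ≤ i ⁻¹ᵁ chart p) :
    (i.appLE (chart p) W h).hom (transition m n p q) * weight i hlam hmu hl hm m n p W =
      weight i hlam hmu hl hm m n q W := by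
  rw [transition_eq, map_mul, map_pow, map_pow, appLE_fracAt, appLE_fracAt, weight, weight,
    ← fracAt_mul (i ≫ pr₁) hlam (X_mem_grading p.1) (X_mem_grading q.1) (le_top.trans hl)
      (h.trans fun _ hz => hz.1),
    ← fracAt_mul (i ≫ pr₂) hmu (X_mem_grading p.2) (X_mem_grading q.2) (le_top.trans hm)
      (h.trans fun _ hz => hz.2)]
  ring

/-- The restriction to `Z` of the section `a` of `𝒪(m, n)` is `φ`, in terms of the generator
`λ ^ m * μ ^ n` of `𝒪(m, n)` along `Z`. -/
def IsTrace {U : P1P1.Opens} (a : lineSections m n U) (φ : Γ(Z, i ⁻¹ᵁ U)) : Prop :=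
  ∀ p, res (i.preimage_mono inf_le_left) φ =
    (i.app (U ⊓ chart p)).hom (a.1 p) * weight i hlam hmu hl hm m n p _

variable {i hlam hmu hl hm}

lemma IsTrace.sub {U : P1P1.Opens} {a b : lineSections m n U} {φ ψ : Γ(Z, i ⁻¹ᵁ U)}
    (ha : IsTrace i hlam hmu hl hm a φ) (hb : IsTrace i hlam hmu hl hm b ψ) :
    IsTrace i hlam hmu hl hm (a - b) (φ - ψ) := by
  intro p
  have : (a - b).1 p = a.1 p - b.1 p := rfl
  rw [this, map_sub, map_sub, ha p, hb p, sub_mul]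

lemma IsTrace.add {U : P1P1.Opens} {a b : lineSections m n U} {φ ψ : Γ(Z, i ⁻¹ᵁ U)}
    (ha : IsTrace i hlam hmu hl hm a φ) (hb : IsTrace i hlam hmu hl hm b ψ) :
    IsTrace i hlam hmu hl hm (a + b) (φ + ψ) := by
  intro p
  have : (a + b).1 p = a.1 p + b.1 p := rfl
  rw [this, map_add, map_add, ha p, hb p, add_mul]

lemma IsTrace.twistRes {U W : P1P1.Opens} {a : lineSections m n U} {φ : Γ(Z, i ⁻¹ᵁ U)}
    (ha : IsTrace i hlam hmu hl hm a φ) (h : W ≤ U) :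
    IsTrace i hlam hmu hl hm (twistRes _ _ _ h a) (res (i.preimage_mono h) φ) := by
  intro p
  have := congr(res (i.preimage_mono (inf_le_inf_right (chart p) h)) $(ha p))
  rw [map_mul, res_weight, ← app_res, res_res] at this
  rw [res_res]
  exact this

/-- The sections of `I_Z(m, n)` are those with zero restriction, as the weights are units. -/
lemma isTrace_zero_iff {U : P1P1.Opens} {a : lineSections m n U} :
    IsTrace i hlam hmu hl hm a 0 ↔ ∀ p, (i.app (U ⊓ chart p)).hom (a.1 p) = 0 := by
  refine forall_congr' fun p => ?_
  rw [map_zero, eq_comm, (isUnit_weight i hlam hmu hl hm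
    (i.preimage_mono inf_le_right)).mul_left_eq_zero]

lemma IsTrace.unique {U : P1P1.Opens} {a : lineSections m n U} {φ ψ : Γ(Z, i ⁻¹ᵁ U)}
    (hφ : IsTrace i hlam hmu hl hm a φ) (hψ : IsTrace i hlam hmu hl hm a ψ) : φ = ψ := by
  refine res_ext (fun p => i ⁻¹ᵁ (U ⊓ chart p)) (fun p => i.preimage_mono inf_le_left) ?_
    fun p => (hφ p).trans (hψ p).symm
  intro x hx
  obtain ⟨p, hp⟩ := Opens.mem_iSup.mp (iSup_chart ▸ Opens.mem_top (i x))
  exact Opens.mem_iSup.mpr ⟨p, hx, hp⟩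

variable (i hlam hmu hl hm) in
lemma exists_isTrace {U : P1P1.Opens} (a : lineSections m n U) :
    ∃ φ, IsTrace i hlam hmu hl hm a φ := by
  obtain ⟨φ, hφ, -⟩ := Z.sheaf.existsUnique_gluing' (fun p => i ⁻¹ᵁ (U ⊓ chart p)) (i ⁻¹ᵁ U)
    (fun p => homOfLE (i.preimage_mono inf_le_left)) (by
      intro x hx
      obtain ⟨p, hp⟩ := Opens.mem_iSup.mp (iSup_chart ▸ Opens.mem_top (i x))
      exact Opens.mem_iSup.mpr ⟨p, hx, hp⟩)
    (fun p => (i.app (U ⊓ chart p)).hom (a.1 p) * weight i hlam hmu hl hm m n p _) (by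
      intro p q
      change res _ _ = res _ _
      let W := U ⊓ chart p ⊓ chart q
      have hWq : W ≤ U ⊓ chart q := le_inf (inf_le_left.trans inf_le_left) inf_le_right
      have hZ : i ⁻¹ᵁ (U ⊓ chart p) ⊓ i ⁻¹ᵁ (U ⊓ chart q) ≤ i ⁻¹ᵁ W := fun z hz => ⟨hz.1, hz.2.2⟩
      have h1 := congr((i.app W).hom $(twistSections_compat _ a p q (W := W)
        (inf_le_left.trans inf_le_left) (inf_le_left.trans inf_le_right) inf_le_right))
      rw [map_mul, app_res, app_res, app_res] at h1
      have h2 := appLE_transition_mul_weight (m := m) (n := n) i hlam hmu hl hm p q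
        (W := i ⁻¹ᵁ W) (i.preimage_mono (inf_le_left.trans inf_le_right))
      have h3 : res (i.preimage_mono inf_le_left) ((i.app (U ⊓ chart p)).hom (a.1 p)) *
          weight i hlam hmu hl hm m n p (i ⁻¹ᵁ W) = res (i.preimage_mono hWq)
          ((i.app (U ⊓ chart q)).hom (a.1 q)) * weight i hlam hmu hl hm m n q (i ⁻¹ᵁ W) := by
        rw [h1, ← h2, Scheme.Hom.appLE]
        change _ = _ * (res _ ((i.app _).hom (transition m n p q)) * _)
        ring
      have h4 := congr(res hZ $h3)
      rwa [map_mul, map_mul, res_weight, res_weight, res_res, res_res, ← res_weight i hlam hmu hl hm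
        p inf_le_left, ← res_weight i hlam hmu hl hm q inf_le_right, ← map_mul, ← map_mul] at h4)
  exact ⟨φ, hφ⟩

/-- If `𝒪(m, n)` splits and its global sections restrict surjectively to a finite scheme `Z`, then
`I_Z(m, n)` splits. -/
theorem splits_idealTwist [DiscreteTopology Z]
    (hglob : ∀ φ, ∃ w : lineSections m n ⊤, IsTrace i hlam hmu hl hm w φ) {U W : P1P1.Opens}
    (h : Splits (lineBundle m n) U W) : Splits (idealTwist i m n) U W := by
  intro (d : twistSections i chart (transition m n) (U ⊓ W))
  let d' : lineSections m n (U ⊓ W) := ⟨d.1, fun _ => Subsingleton.elim _ _, d.2.2⟩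
  obtain ⟨(a : lineSections m n U), (b : lineSections m n W), hab⟩ := h d'
  replace hab : d' = twistRes _ _ _ inf_le_left a - twistRes _ _ _ inf_le_right b := hab
  obtain ⟨φ, hφ⟩ := exists_isTrace i hlam hmu hl hm a
  obtain ⟨ψ, hψ⟩ := exists_isTrace i hlam hmu hl hm b
  have hd' : IsTrace i hlam hmu hl hm d' 0 := isTrace_zero_iff.mpr d.2.1
  have h0 := (hφ.twistRes (inf_le_left : U ⊓ W ≤ U)).sub (hψ.twistRes (inf_le_right : U ⊓ W ≤ W))
  rw [← hab] at h0
  obtain ⟨χ, rfl, rfl⟩ := exists_glue_top φ ψ (sub_eq_zero.mp (h0.unique hd'))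
  obtain ⟨w, hw⟩ := hglob χ
  have key {V : P1P1.Opens} {s : lineSections m n V}
      (hs : IsTrace i hlam hmu hl hm s (res le_top χ)) (p : Fin 2 × Fin 2) :
      (i.app (V ⊓ chart p)).hom ((s - twistRes _ _ _ le_top w).1 p) = 0 := by
    refine (isTrace_zero_iff (hlam := hlam) (hmu := hmu) (hl := hl) (hm := hm)).mp ?_ p
    rw [← sub_self (res le_top χ : Γ(Z, i ⁻¹ᵁ V))]
    exact hs.sub (hw.twistRes le_top)
  let a' : twistSections i chart (transition m n) U := ⟨_, key hφ, (a - twistRes _ _ _ le_top w).2.2⟩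
  let b' : twistSections i chart (transition m n) W := ⟨_, key hψ, (b - twistRes _ _ _ le_top w).2.2⟩
  refine ⟨a', b', ?_⟩
  apply Subtype.ext
  have h1 : d' = twistRes _ _ _ inf_le_left (a - twistRes _ _ _ le_top w) -
      twistRes _ _ _ inf_le_right (b - twistRes _ _ _ le_top w) := by
    rw [map_sub, map_sub, hab, sub_sub_sub_comm]
    refine (sub_eq_self.mpr (sub_eq_zero.mpr ?_)).symm
    apply Subtype.ext
    funext p
    exact (res_res _ _ _).trans (res_res _ _ _).symm
  exact congr(($h1).1)

end Traces

/-! ### Coordinates on a finite subscheme -/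

section LinearForms

open MvPolynomial

/-- The linear form with the coefficients `α`. -/
def linForm (α : Fin 2 → ℂ) : MvPolynomial (Fin 2) ℂ := C (α 0) * X 0 + C (α 1) * X 1

lemma linForm_mem (α : Fin 2 → ℂ) : linForm α ∈ grading 1 :=
  Submodule.add_mem _ (IsHomogeneous.C_mul (isHomogeneous_X ℂ 0) _)
    (IsHomogeneous.C_mul (isHomogeneous_X ℂ 1) _)

/-- A linear form which does not vanish at any of the finitely many images of points of `Z`. -/
lemma exists_linForm {Z : Scheme.{0}} [Finite Z] (g : Z ⟶ P1) :
    ∃ α : Fin 2 → ℂ, α ≠ 0 ∧ ⊤ ≤ g ⁻¹ᵁ linOpen (linForm α) := by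
  classical
  have := Fintype.ofFinite Z
  let L : (Fin 2 → ℂ) →ₗ[ℂ] MvPolynomial (Fin 2) ℂ :=
    { toFun := linForm
      map_add' := fun α β => by simp only [linForm, Pi.add_apply, C_add]; ring
      map_smul' := fun c α => by
        simp only [linForm, Pi.smul_apply, smul_eq_mul, C_mul, smul_eq_C_mul, RingHom.id_apply]
        ring }
  let S (z : Z) : Subspace ℂ (Fin 2 → ℂ) :=
    ((g z).asHomogeneousIdeal.toIdeal.restrictScalars ℂ).comap L
  have hS (z : Z) : S z ≠ ⊤ := by
    intro h
    obtain ⟨a, ha⟩ := exists_mem_chart (g z)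
    have h1 : Pi.single a 1 ∈ S z := h ▸ Submodule.mem_top
    have h2 : linForm (Pi.single a 1) ∈ (g z).asHomogeneousIdeal := h1
    have h3 : linForm (Pi.single a 1) = X a := by
      fin_cases a <;> simp [linForm]
    exact ha (h3 ▸ h2)
  -- The zero subspace is avoided as well, so that `α ≠ 0` even if `Z` is empty.
  have hne := Subspace.biUnion_ne_univ_of_top_notMem (k := ℂ)
    (s := insert ⊥ (Finset.univ.image S)) (by
      rw [Finset.mem_insert, Finset.mem_image]
      rintro (h | ⟨z, -, h⟩)
      · exact top_ne_bot h
      · exact hS z h)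
  obtain ⟨α, hα⟩ := (Set.ne_univ_iff_exists_notMem _).mp hne
  simp only [Set.mem_iUnion, not_exists] at hα
  refine ⟨α, fun h => hα ⊥ (Finset.mem_insert_self _ _) h, fun z _ hz => ?_⟩
  exact hα (S z) (Finset.mem_insert_of_mem (Finset.mem_image_of_mem S (Finset.mem_univ z))) hz

lemma fracAt_eq_sum {Y : Scheme.{0}} (f : Y ⟶ P1) {lam mu : MvPolynomial (Fin 2) ℂ}
    (hlam : lam ∈ grading 1) (hmu : mu ∈ grading 1) {W : Y.Opens} (hW : W ≤ f ⁻¹ᵁ linOpen lam) :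
    fracAt f hlam hmu hW = eval₂ (constHom (f ≫ P1.toSpecC) W)
      (fun k => fracAt f hlam (X_mem_grading k) hW) mu := by
  rw [fracAt, frac_eq_sum hlam hmu, hom_eval₂]
  congr 1
  ext c
  exact appLE_constHom f P1.toSpecC hW c

end LinearForms

section Sections

variable {Z : Scheme.{0}}

lemma length_eq_finrank (f : Z ⟶ specC) [Algebra ℂ Γ(Z, ⊤)]
    (h : algebraMap ℂ Γ(Z, ⊤) = constHom f ⊤) : length f = Module.finrank ℂ Γ(Z, ⊤) := by
  have h1 : f.appLE ⊤ ⊤ le_top = f.appTop := Scheme.Hom.appLE_eq_app _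
  rw [constHom, h1] at h
  rw [length]
  congr 1
  congr 1
  exact Algebra.algebra_ext _ _ fun c => congr($h.symm c)

lemma finite_sections (f : Z ⟶ specC) [IsFinite f] [Algebra ℂ Γ(Z, ⊤)]
    (h : algebraMap ℂ Γ(Z, ⊤) = constHom f ⊤) : Module.Finite ℂ Γ(Z, ⊤) := by
  rw [← RingHom.finite_algebraMap, h, constHom, CommRingCat.hom_comp]
  have h1 : f.appLE ⊤ ⊤ le_top = f.appTop := Scheme.Hom.appLE_eq_app _
  rw [h1]
  refine RingHom.Finite.comp f.finite_appTop (RingHom.Finite.of_surjective _ ?_)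
  exact (ConcreteCategory.bijective_of_isIso (Scheme.ΓSpecIso (CommRingCat.of ℂ)).inv).2

lemma isArtinianScheme_of_isFinite (f : Z ⟶ specC) [IsFinite f] : IsArtinianScheme Z := by
  have : IsAffine Z := isAffine_of_isAffineHom f
  let : Algebra ℂ Γ(Z, ⊤) := (constHom f ⊤).toAlgebra
  have := finite_sections f rfl
  have : IsArtinianRing Γ(Z, ⊤) := IsArtinianRing.of_finite ℂ _
  have : IsLocallyArtinian Z := IsLocallyArtinian.of_isImmersion Z.isoSpec.hom
  have : CompactSpace Z := inferInstance
  exact {}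

instance : IsSeparated P1.toSpecC := by
  unfold P1.toSpecC
  infer_instance

/-- The functions on an affine `Z ⊆ D₊(λ) × D₊(μ)` are generated by the coordinates. -/
lemma subring_eq_top_of_isClosedImmersion (i : Z ⟶ P1P1) [IsClosedImmersion i]
    {lam mu : MvPolynomial (Fin 2) ℂ}
    (hlam : lam ∈ grading 1) (hmu : mu ∈ grading 1) (hl : ⊤ ≤ (i ≫ pr₁) ⁻¹ᵁ linOpen lam)
    (hm : ⊤ ≤ (i ≫ pr₂) ⁻¹ᵁ linOpen mu) (S : Subring Γ(Z, ⊤))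
    (hc : ∀ c, constHom (i ≫ P1P1.toSpecC) ⊤ c ∈ S)
    (h₁ : ∀ k, fracAt (i ≫ pr₁) hlam (X_mem_grading k) hl ∈ S)
    (h₂ : ∀ k, fracAt (i ≫ pr₂) hmu (X_mem_grading k) hm ∈ S) : S = ⊤ := by
  have hle : ⊤ ≤ i ⁻¹ᵁ box lam mu := fun z hz => ⟨hl hz, hm hz⟩
  have := subring_eq_top_of_box hlam hmu (S.comap (i.appLE (box lam mu) ⊤ hle).hom)
    (fun c => by
      rw [Subring.mem_comap, appLE_constHom]
      exact hc c)
    (fun k => by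
      rw [Subring.mem_comap, appLE_fracAt]
      exact h₁ k)
    (fun k => by
      rw [Subring.mem_comap, appLE_fracAt]
      exact h₂ k)
  rw [eq_top_iff]
  intro z _
  obtain ⟨y, hy⟩ := i.app_surjective (box lam mu) (isAffineOpen_box hlam hmu)
    (res (W := i ⁻¹ᵁ box lam mu) le_top z)
  have hyz : (i.appLE (box lam mu) ⊤ hle).hom y = z := by
    change res hle ((i.app _).hom y) = z
    refine (congr(res hle $hy)).trans ?_
    rw [res_res]
    exact congr($(Z.presheaf.map_id _) z)
  rw [← hyz]
  exact (this ▸ Subring.mem_top y : y ∈ S.comap _)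

/-- The quotient of the functions on `Z` in which the coordinates along `pr` are constant is bounded by
the length of the intersection of `Z` with a fibre of `pr`. -/
lemma finrank_quotient_le_lengthInter (pr : P1P1 ⟶ P1) (hpr : pr ≫ P1.toSpecC = P1P1.toSpecC)
    (i : Z ⟶ P1P1) [IsFinite (i ≫ P1P1.toSpecC)] {lam : MvPolynomial (Fin 2) ℂ}
    (hlam : lam ∈ grading 1) (hl : ⊤ ≤ (i ≫ pr) ⁻¹ᵁ linOpen lam) [Algebra ℂ Γ(Z, ⊤)]
    (halg : algebraMap ℂ Γ(Z, ⊤) = constHom (i ≫ P1P1.toSpecC) ⊤) (c : Fin 2 → ℂ)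
    (hc : MvPolynomial.eval₂ (RingHom.id ℂ) c lam = 1) (J : Ideal Γ(Z, ⊤))
    (hJ : ∀ k, fracAt (i ≫ pr) hlam (X_mem_grading k) hl - algebraMap ℂ _ (c k) ∈ J) :
    ∃ a : specC ⟶ P1, a ≫ P1.toSpecC = 𝟙 specC ∧
      Module.finrank ℂ (Γ(Z, ⊤) ⧸ J) ≤ lengthInter i (Limits.pullback.fst pr a) := by
  have : IsAffine Z := isAffine_of_isAffineHom (i ≫ P1P1.toSpecC)
  obtain ⟨a, ha, hac, hak⟩ := exists_point hlam (RingHom.id ℂ) c hc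
  replace hac : a ≫ P1.toSpecC = 𝟙 specC := hac.trans (Spec.map_id _)
  refine ⟨a, hac, ?_⟩
  let B := Γ(Z, ⊤) ⧸ J
  let f : Spec (CommRingCat.of B) ⟶ Z :=
    Spec.map (CommRingCat.ofHom (Ideal.Quotient.mk J)) ≫ Z.isoSpec.inv
  let σ : Spec (CommRingCat.of B) ⟶ specC := Spec.map (CommRingCat.ofHom (algebraMap ℂ B))
  have hfσ : f ≫ i ≫ P1P1.toSpecC = σ := by
    have := fromSpec_comp_toSpecC (i ≫ P1P1.toSpecC) (isAffineOpen_top Z)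
    rw [IsAffineOpen.fromSpec_top, ← halg] at this
    rw [Category.assoc, this, ← Spec.map_comp]
    rfl
  have hf : ⊤ ≤ f ⁻¹ᵁ ⊤ := le_top
  have happ : f.appLE ⊤ ⊤ hf = CommRingCat.ofHom (Ideal.Quotient.mk J) ≫
      (Scheme.ΓSpecIso (CommRingCat.of B)).inv := by
    apply Spec.map_injective
    rw [← cancel_mono (isAffineOpen_top Z).fromSpec,
      IsAffineOpen.SpecMap_appLE_fromSpec f (isAffineOpen_top _) (isAffineOpen_top _) hf,
      IsAffineOpen.fromSpec_top, IsAffineOpen.fromSpec_top, Scheme.isoSpec_Spec_inv, Spec.map_comp,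
      Category.assoc]
  have hfz (z : Γ(Z, ⊤)) : specHom f ⊤ hf z = Ideal.Quotient.mk J z := by
    rw [specHom, happ, Category.assoc, Iso.inv_hom_id, Category.comp_id, CommRingCat.hom_ofHom]
  have hf0 {z : Γ(Z, ⊤)} (hz : z ∈ J) : (f.appLE ⊤ ⊤ hf).hom z = 0 := by
    rw [happ, CommRingCat.hom_comp, RingHom.comp_apply, CommRingCat.hom_ofHom,
      Ideal.Quotient.eq_zero_iff_mem.mpr hz, map_zero]
  have hpt : (f ≫ i) ≫ pr = σ ≫ a := by
    refine hom_P1_ext hlam _ _ (fun z _ => hl (Set.mem_univ (f z)))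
      (fun z _ => ha (Set.mem_univ (σ z))) ?_ fun k => ?_
    · rw [Category.assoc, hpr, Category.assoc, hfσ, Category.assoc, hac, Category.comp_id]
    · have h1 := hf0 (hJ k)
      rw [map_sub, halg, appLE_constHom, hfσ, sub_eq_zero] at h1
      refine Eq.trans ?_ (h1.trans ?_)
      · exact congr($(f.appLE_comp_appLE (i ≫ pr) _ ⊤ ⊤ hl hf).hom
          (frac hlam (X_mem_grading k))).symm
      · refine Eq.trans ?_ congr($(σ.appLE_comp_appLE a _ ⊤ ⊤ ha le_top).hom
          (frac hlam (X_mem_grading k)))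
        exact congr((σ.appLE ⊤ ⊤ le_top).hom $((hak k).symm))
  -- `Spec (Γ(Z, ⊤) ⧸ J)` maps to the intersection of `Z` with the fibre over `a`.
  let k₁ : Spec (CommRingCat.of B) ⟶ Limits.pullback pr a := Limits.pullback.lift (f ≫ i) σ hpt
  let k₂ : Spec (CommRingCat.of B) ⟶ Limits.pullback i (Limits.pullback.fst pr a) :=
    Limits.pullback.lift f k₁ (Limits.pullback.lift_fst _ _ _).symm
  have hk₂ : k₂ ≫ Limits.pullback.fst _ _ = f := Limits.pullback.lift_fst _ _ _
  let t := Limits.pullback.fst i (Limits.pullback.fst pr a) ≫ i ≫ P1P1.toSpecC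
  have hkt : k₂ ≫ t = σ := by rw [← hfσ, ← hk₂, Category.assoc]
  have : IsFinite (a ≫ P1.toSpecC) := by
    rw [hac]
    infer_instance
  have : IsFinite a := IsFinite.of_comp a P1.toSpecC
  have : IsFinite t := inferInstance
  let : Algebra ℂ Γ(Limits.pullback i (Limits.pullback.fst pr a), ⊤) := (constHom t ⊤).toAlgebra
  have := finite_sections t rfl
  rw [lengthInter, length_eq_finrank t rfl]
  let ℓ : Γ(Limits.pullback i (Limits.pullback.fst pr a), ⊤) →ₐ[ℂ] B :=
    { specHom k₂ ⊤ le_top with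
      commutes' := fun c => specHom_constHom k₂ t _ hkt le_top c }
  refine LinearMap.finrank_le_finrank_of_surjective (f := ℓ.toLinearMap) fun b => ?_
  obtain ⟨z, rfl⟩ := Ideal.Quotient.mk_surjective b
  refine ⟨((Limits.pullback.fst i (Limits.pullback.fst pr a)).appLE ⊤ ⊤ le_top).hom z, ?_⟩
  refine (specHom_comp k₂ (Limits.pullback.fst _ _) le_top le_top le_top z).trans ?_
  rw [← hfz]
  congr 1
  simp only [hk₂]

end Sections

/-! ### Surjectivity of restriction and vanishing of cohomology -/

section Coordinates

open scoped Pointwise in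
lemma exists_of_mem_pair_pow {M : Type*} [CommRing M] {a b z : M} {m : ℕ} (h : z ∈ ({a, b} : Set M) ^ m) :
    ∃ j ≤ m, z = a ^ (m - j) * b ^ j := by
  induction m generalizing z with
  | zero => exact ⟨0, le_rfl, by simpa using h⟩
  | succ m ih =>
    rw [pow_succ, Set.mem_mul] at h
    obtain ⟨w, hw, t, ht, rfl⟩ := h
    obtain ⟨j, hj, rfl⟩ := ih hw
    rcases ht with rfl | rfl
    · exact ⟨j, hj.trans m.le_succ, by rw [Nat.succ_sub hj, pow_succ]; ring⟩
    · exact ⟨j + 1, Nat.succ_le_succ hj, by rw [Nat.succ_sub_succ, pow_succ]; ring⟩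

variable {A : Type*} [CommRing A] [Algebra ℂ A]

/-- If a linear form has the value `1` at `u 0`, `u 1`, one of these is an affine coordinate `x`, in that
the other is an affine function of `x`. -/
lemma exists_affine_coordinate {α : Fin 2 → ℂ} (hα : α ≠ 0) {u : Fin 2 → A}
    (hu : algebraMap ℂ A (α 0) * u 0 + algebraMap ℂ A (α 1) * u 1 = 1) :
    ∃ k, (∀ j, u j ∈ Submodule.span ℂ {1, u k}) ∧ 1 ∈ Submodule.span ℂ {u 0, u 1} ∧
      ∀ a : ℂ, ∃ c : Fin 2 → ℂ, α 0 * c 0 + α 1 * c 1 = 1 ∧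
        ∀ j, u j - algebraMap ℂ A (c j) ∈ Ideal.span {u k - algebraMap ℂ A a} := by
  have h1 : (1 : A) ∈ Submodule.span ℂ {u 0, u 1} := by
    rw [Submodule.mem_span_pair]
    exact ⟨α 0, α 1, by rw [Algebra.smul_def, Algebra.smul_def, hu]⟩
  have key {β γ : ℂ} {x z : A} (hγ : γ ≠ 0)
      (h : algebraMap ℂ A β * x + algebraMap ℂ A γ * z = 1) :
      z = algebraMap ℂ A γ⁻¹ - algebraMap ℂ A (γ⁻¹ * β) * x := by
    have h2 : algebraMap ℂ A γ⁻¹ * algebraMap ℂ A γ = 1 := by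
      rw [← map_mul, inv_mul_cancel₀ hγ, map_one]
    rw [map_mul]
    linear_combination algebraMap ℂ A γ⁻¹ * h - z * h2
  have hmem {β γ : ℂ} {x z : A} (hγ : γ ≠ 0)
      (h : algebraMap ℂ A β * x + algebraMap ℂ A γ * z = 1) : z ∈ Submodule.span ℂ {1, x} := by
    rw [Submodule.mem_span_pair]
    refine ⟨γ⁻¹, -(γ⁻¹ * β), ?_⟩
    rw [key hγ h, Algebra.smul_def, Algebra.smul_def, map_neg]
    ring
  have hideal {β γ : ℂ} {x z : A} (hγ : γ ≠ 0)
      (h : algebraMap ℂ A β * x + algebraMap ℂ A γ * z = 1) (a : ℂ) :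
      z - algebraMap ℂ A (γ⁻¹ * (1 - β * a)) ∈ Ideal.span {x - algebraMap ℂ A a} := by
    rw [Ideal.mem_span_singleton]
    refine ⟨-algebraMap ℂ A (γ⁻¹ * β), ?_⟩
    rw [key hγ h]
    simp only [map_mul, map_sub, map_one]
    ring
  by_cases h : α 1 = 0
  · have h0 : α 0 ≠ 0 := fun h0 => hα (by
      ext j
      fin_cases j
      exacts [h0, h])
    have hu' := (add_comm _ _).trans hu
    refine ⟨1, fun j => ?_, h1, fun a => ⟨![(α 0)⁻¹ * (1 - α 1 * a), a], ?_, fun j => ?_⟩⟩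
    · fin_cases j
      exacts [hmem h0 hu', Submodule.subset_span (by simp)]
    · simp [h0]
    · fin_cases j
      exacts [hideal h0 hu' a, Ideal.subset_span rfl]
  · refine ⟨0, fun j => ?_, h1, fun a => ⟨![a, (α 1)⁻¹ * (1 - α 0 * a)], ?_, fun j => ?_⟩⟩
    · fin_cases j
      exacts [Submodule.subset_span (by simp), hmem h hu]
    · simp [h]
    · fin_cases j
      exacts [Ideal.subset_span rfl, hideal h hu a]

open scoped Pointwise in
/-- A product of powers of spans of pairs is spanned by monomials. -/
lemma span_pow_mul_span_pow_le (a b c d : A) (m n : ℕ) :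
    Submodule.span ℂ {a, b} ^ m * Submodule.span ℂ {c, d} ^ n ≤ Submodule.span ℂ
      {z | ∃ j k, j ≤ m ∧ k ≤ n ∧ z = (a ^ (m - j) * b ^ j) * (c ^ (n - k) * d ^ k)} := by
  rw [Submodule.span_pow, Submodule.span_pow, Submodule.span_mul_span]
  refine Submodule.span_mono ?_
  rintro _ ⟨s, hs, t, ht, rfl⟩
  obtain ⟨j, hj, rfl⟩ := exists_of_mem_pair_pow hs
  obtain ⟨k, hk, rfl⟩ := exists_of_mem_pair_pow ht
  exact ⟨j, k, hj, hk, rfl⟩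

end Coordinates

section Restriction

variable {m n : ℕ} {Z : Scheme.{0}} {i : Z ⟶ P1P1}

/-- The restriction of a monomial section to `Z`. -/
lemma exists_isTrace_monomial {lam mu : MvPolynomial (Fin 2) ℂ}
    (hlam : lam ∈ grading 1) (hmu : mu ∈ grading 1) (hl : ⊤ ≤ (i ≫ pr₁) ⁻¹ᵁ linOpen lam)
    (hm : ⊤ ≤ (i ≫ pr₂) ⁻¹ᵁ linOpen mu) {j k : ℕ} (hj : j ≤ m) (hk : k ≤ n) (c : ℂ) :
    ∃ w : lineSections m n ⊤, IsTrace i hlam hmu hl hm w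
      (constHom (i ≫ P1P1.toSpecC) ⊤ c *
        ((fracAt (i ≫ pr₁) hlam (X_mem_grading 0) hl ^ (m - j) *
          fracAt (i ≫ pr₁) hlam (X_mem_grading 1) hl ^ j) *
        (fracAt (i ≫ pr₂) hmu (X_mem_grading 0) hm ^ (n - k) *
          fracAt (i ≫ pr₂) hmu (X_mem_grading 1) hm ^ k))) := by
  obtain ⟨w, hw⟩ := exists_secExpand_top hj hk c
  refine ⟨w, fun p => ?_⟩
  rw [component_of_secExpand hj hk hw p]
  obtain ⟨m, rfl⟩ := Nat.exists_eq_add_of_le' hj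
  obtain ⟨n, rfl⟩ := Nat.exists_eq_add_of_le' hk
  have hc : (i.app (⊤ ⊓ chart p)).hom (constHom P1P1.toSpecC _ c) =
      constHom (i ≫ P1P1.toSpecC) _ c := by
    rw [← appLE_constHom i P1P1.toSpecC le_rfl, Scheme.Hom.appLE_eq_app]
  change res (le_top : i ⁻¹ᵁ (⊤ ⊓ chart p) ≤ ⊤) _ = _
  simp only [map_mul, map_pow, app_fracAt, res_fracAt, res_constHom, hc, weight,
    Nat.add_sub_cancel]
  have h₁ (a : Fin 2) := fracAt_mul (i ≫ pr₁) hlam (X_mem_grading p.1) (X_mem_grading a)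
    (W := i ⁻¹ᵁ (⊤ ⊓ chart p)) (le_top.trans hl) fun _ hz => hz.2.1
  have h₂ (a : Fin 2) := fracAt_mul (i ≫ pr₂) hmu (X_mem_grading p.2) (X_mem_grading a)
    (W := i ⁻¹ᵁ (⊤ ⊓ chart p)) (le_top.trans hm) fun _ hz => hz.2.2
  rw [← h₁ 0, ← h₁ 1, ← h₂ 0, ← h₂ 1]
  ring

/-- The global sections of `𝒪(m, n)` restrict surjectively to a finite subscheme `Z` of length at most
`m + n + 1` which satisfies the bounds on intersections with lines. -/
theorem exists_isTrace_of_lengthInter_le [IsClosedImmersion i] [IsFinite (i ≫ P1P1.toSpecC)]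
    (hlen : length (i ≫ P1P1.toSpecC) ≤ m + n + 1)
    (hD : ∀ a : specC ⟶ P1, a ≫ P1.toSpecC = 𝟙 specC → lengthInter i (line₁₀ a) ≤ n + 1)
    (hE : ∀ b : specC ⟶ P1, b ≫ P1.toSpecC = 𝟙 specC → lengthInter i (line₀₁ b) ≤ m + 1)
    {α β : Fin 2 → ℂ} (hα : α ≠ 0) (hβ : β ≠ 0) (hl : ⊤ ≤ (i ≫ pr₁) ⁻¹ᵁ linOpen (linForm α))
    (hm : ⊤ ≤ (i ≫ pr₂) ⁻¹ᵁ linOpen (linForm β)) (φ : Γ(Z, ⊤)) :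
    ∃ w : lineSections m n ⊤, IsTrace i (linForm_mem α) (linForm_mem β) hl hm w φ := by
  let _ : Algebra ℂ Γ(Z, ⊤) := (constHom (i ≫ P1P1.toSpecC) ⊤).toAlgebra
  have := finite_sections (i ≫ P1P1.toSpecC) rfl
  rw [length_eq_finrank _ rfl] at hlen
  let u (k : Fin 2) : Γ(Z, ⊤) := fracAt (i ≫ pr₁) (linForm_mem α) (X_mem_grading k) hl
  let v (k : Fin 2) : Γ(Z, ⊤) := fracAt (i ≫ pr₂) (linForm_mem β) (X_mem_grading k) hm
  have hu : algebraMap ℂ Γ(Z, ⊤) (α 0) * u 0 + algebraMap ℂ Γ(Z, ⊤) (α 1) * u 1 = 1 := by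
    rw [← fracAt_self (i ≫ pr₁) (linForm_mem α) hl, fracAt_eq_sum]
    simp only [linForm, MvPolynomial.eval₂_add, MvPolynomial.eval₂_mul, MvPolynomial.eval₂_C,
      MvPolynomial.eval₂_X, Category.assoc, pr₁_toSpecC]
    rfl
  have hv : algebraMap ℂ Γ(Z, ⊤) (β 0) * v 0 + algebraMap ℂ Γ(Z, ⊤) (β 1) * v 1 = 1 := by
    rw [← fracAt_self (i ≫ pr₂) (linForm_mem β) hm, fracAt_eq_sum]
    simp only [linForm, MvPolynomial.eval₂_add, MvPolynomial.eval₂_mul, MvPolynomial.eval₂_C,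
      MvPolynomial.eval₂_X, Category.assoc, pr₂_toSpecC]
    rfl
  obtain ⟨k, huk, hu1, huc⟩ := exists_affine_coordinate hα hu
  obtain ⟨l, hvl, hv1, hvc⟩ := exists_affine_coordinate hβ hv
  have hspan_le (w : Fin 2 → Γ(Z, ⊤)) (k : Fin 2) (h1 : 1 ∈ Submodule.span ℂ {w 0, w 1}) :
      Submodule.span ℂ {1, w k} ≤ Submodule.span ℂ {w 0, w 1} := by
    rw [Submodule.span_le, Set.insert_subset_iff, Set.singleton_subset_iff]
    refine ⟨h1, Submodule.subset_span ?_⟩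
    fin_cases k <;> simp
  have hadj : Algebra.adjoin ℂ {u k, v l} = ⊤ := by
    have hle {x : Γ(Z, ⊤)} (hx : x ∈ ({u k, v l} : Set Γ(Z, ⊤))) :
        Submodule.span ℂ {1, x} ≤ Subalgebra.toSubmodule (Algebra.adjoin ℂ {u k, v l}) := by
      rw [Submodule.span_le, Set.insert_subset_iff, Set.singleton_subset_iff]
      exact ⟨one_mem (Algebra.adjoin ℂ _), Algebra.subset_adjoin hx⟩
    have := subring_eq_top_of_isClosedImmersion i (linForm_mem α) (linForm_mem β) hl hm
      (Algebra.adjoin ℂ {u k, v l}).toSubring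
      (fun c => Subalgebra.algebraMap_mem (Algebra.adjoin ℂ {u k, v l}) c)
      (fun j => hle (by simp) (huk j)) (fun j => hle (by simp) (hvl j))
    rw [eq_top_iff]
    intro z _
    exact (this ▸ Subring.mem_top z : z ∈ (Algebra.adjoin ℂ {u k, v l}).toSubring)
  have htop := span_pow_mul_span_pow_eq_top hadj hlen
    (fun a => by
      obtain ⟨c, hc, hJ⟩ := huc a
      obtain ⟨pt, hpt, hle⟩ := finrank_quotient_le_lengthInter pr₁ pr₁_toSpecC i (linForm_mem α) hl
        rfl c (by simpa [linForm] using hc) _ hJ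
      exact hle.trans (hD pt hpt))
    (fun b => by
      obtain ⟨c, hc, hJ⟩ := hvc b
      obtain ⟨pt, hpt, hle⟩ := finrank_quotient_le_lengthInter pr₂ pr₂_toSpecC i (linForm_mem β) hm
        rfl c (by simpa [linForm] using hc) _ hJ
      exact hle.trans (hE pt hpt))
  have hφ : φ ∈ Submodule.span ℂ {z | ∃ j k, j ≤ m ∧ k ≤ n ∧
      z = (u 0 ^ (m - j) * u 1 ^ j) * (v 0 ^ (n - k) * v 1 ^ k)} := by
    refine span_pow_mul_span_pow_le _ _ _ _ m n ?_
    refine mul_le_mul' (pow_le_pow_left' (hspan_le u k hu1) m)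
      (pow_le_pow_left' (hspan_le v l hv1) n) ?_
    rw [htop]
    exact Submodule.mem_top
  induction hφ using Submodule.closure_induction with
  | zero => exact ⟨0, isTrace_zero_iff.mpr fun p => map_zero _⟩
  | add x y _ _ hx hy =>
    obtain ⟨w, hw⟩ := hx
    obtain ⟨w', hw'⟩ := hy
    exact ⟨w + w', hw.add hw'⟩
  | smul_mem c x hx =>
    obtain ⟨j, k, hj, hk, rfl⟩ := hx
    rw [Algebra.smul_def]
    exact exists_isTrace_monomial _ _ hl hm hj hk c

end Restriction

section Vanishing

variable {m n : ℕ} {Z : Scheme.{0}} {i : Z ⟶ P1P1}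

lemma liftsOver_chart [IsAffineHom i] {S : ShortComplex (TopCat.Sheaf AddCommGrpCat.{0} P1P1)}
    (hS : S.ShortExact) (hF : S.X₁ = idealTwist i m n) (q : S.X₃.obj.obj (op ⊤))
    (p : Fin 2 × Fin 2) : LiftsOver q (chart p) := by
  refine LiftsOver.of_isAffineOpen hS q
    (isAffineOpen_box (X_mem_grading p.1) (X_mem_grading p.2)) fun U hU hUa f h hfh => ?_
  rw [hF]
  exact splits_basicOpen i (isCocycle_transition m n) hU hUa f h hfh

/-- If `I_Z(m, n)` splits wherever `𝒪(m, n)` does, its first cohomology vanishes. -/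
theorem subsingleton_H_one_idealTwist [IsAffineHom i]
    (h : ∀ U W, Splits (lineBundle m n) U W → Splits (idealTwist i m n) U W) :
    Subsingleton (Sheaf.H (idealTwist i m n) 1) := by
  refine subsingleton_H_one _ fun S hS hF q => ?_
  have hcol (b : Fin 2) : LiftsOver q (chart (0, b) ⊔ chart (1, b)) :=
    (liftsOver_chart hS hF q _).sup hS (liftsOver_chart hS hF q _)
      (hF ▸ h _ _ (splits_lineBundle_chart m n b))
  refine ((hcol 0).sup hS (hcol 1) (hF ▸ h _ _ (splits_lineBundle_sup m n))).mono ?_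
  rw [← iSup_chart, iSup_le_iff]
  rintro ⟨a, b⟩
  fin_cases a <;> fin_cases b
  exacts [le_sup_left.trans le_sup_left, le_sup_left.trans le_sup_right,
    le_sup_right.trans le_sup_left, le_sup_right.trans le_sup_right]

end Vanishing

end BiProj

end

theorem theorem4p5 {Z : Scheme.{0}} (i : Z ⟶ BiProj.P1P1) [IsClosedImmersion i]
    [IsFinite (i ≫ BiProj.P1P1.toSpecC)]
    (l : ℕ) (hl : BiProj.length (i ≫ BiProj.P1P1.toSpecC) = l)
    (m n : ℕ) (hmn : (l : ℤ) - 1 ≤ (m : ℤ) + (n : ℤ))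
    (hD : ∀ a : BiProj.specC ⟶ BiProj.P1, a ≫ BiProj.P1.toSpecC = 𝟙 BiProj.specC →
      BiProj.lengthInter i (BiProj.line₁₀ a) ≤ n + 1)
    (hE : ∀ b : BiProj.specC ⟶ BiProj.P1, b ≫ BiProj.P1.toSpecC = 𝟙 BiProj.specC →
      BiProj.lengthInter i (BiProj.line₀₁ b) ≤ m + 1) :
    Subsingleton (Sheaf.H (BiProj.idealTwist i m n) 1) := by
  have := BiProj.isArtinianScheme_of_isFinite (i ≫ BiProj.P1P1.toSpecC)
  obtain ⟨α, hα, hZα⟩ := BiProj.exists_linForm (i ≫ BiProj.pr₁)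
  obtain ⟨β, hβ, hZβ⟩ := BiProj.exists_linForm (i ≫ BiProj.pr₂)
  refine BiProj.subsingleton_H_one_idealTwist fun U W => BiProj.splits_idealTwist fun φ =>
    BiProj.exists_isTrace_of_lengthInter_le (by omega) hD hE hα hβ hZα hZβ φ
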